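/- Let $N\ge 1$ and $k\ge 3$ be integers and $v=(c,d)\in(\mathbb Z/N)^2$. For $\tau$ in the upper half-plane $\mathbb H$ and integers $r,s\ge 0$ with $r+s=k-2$ put $$G_k^v(\tau)=\sum_{(m,n)}\frac1{(m\tau+n)^k},\qquad G_{r,s}^v(\tau)=\sum_{(m,n)}\frac{\operatorname{Im}\tau}{(m\tau+n)^{r+1}(m\bar\tau+n)^{s+1}},$$ both sums over all $(m,n)\in\mathbb Z^2\setminus\{(0,0)\}$ with $(m,n)\equiv v \bmod N$. Let $a_0$ be the constant Fourier coefficient of $G_k^v$ (in powers of $q_N=e^{2\pi i\tau/N}$), and for $0\le p\le k-2$ define the integral regularised at the unit tangent vector at infinity by $$\int_\tau^{\vec 1_\infty}G_k^v(z)z^p\,dz=-\frac{a_0\tau^{p+1}}{p+1}+\int_\tau^{i\infty}\bigl(G_k^v(z)-a_0\bigr)z^p\,dz ,$$ the last integral being taken along the vertical ray; extend this linearly to polynomials in $z$ and set $\int_{\vec 1_\infty}^{\tau}=-\int_\tau^{\vec 1_\infty}$. Write $\underline{G_k^v}(z)=2\pi i\,G_k^v(z)(X-zY)^{k-2}dz$,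 and let $\operatorname{Re}$ act on the coefficients of polynomials in $X,Y$. Let $\operatorname{Cl}_m(x)$ be the real part ($m$ odd) or imaginary part ($m$ even) of $\sum_{n\ge1}e^{inx}/n^m$. For $u=(a,b)\in(\mathbb Z/N)^2$ let $(u|v)=ad-bc$ and $$A_{\xi_k^u}=(-1)^{k-1+\lceil k/2\rceil}\,\delta_{a,0}\,\frac{(k-2)!}{(2\pi)^{k-2}}\operatorname{Cl}_{k-1}\!\Bigl(\frac{2\pi b}N\Bigr),$$ $$A_{G_k^v}=\frac{(-1)^{\lfloor k/2\rfloor}(2\pi)^k}{N^2(k-1)!}\sum_{u\in(\mathbb Z/N)^2}A_{\xi_k^u}\cdot\begin{cases}\cos\frac{2\pi(u|v)}N,&k\text{ even},\\ \sin\frac{2\pi(u|v)}N,&k\text{ odd},\end{cases}$$ $P_{G_k^v}=A_{G_k^v}Y^{k-2}$, and $$\mathcal G_k^v(\tau)=P_{G_k^v}+\operatorname{Re}\int_{\vec 1_\infty}^\tau\underline{G_k^v}.$$ Then the series and integrals above converge absolutely, and for every $\tau\in\mathbb H$ $$\mathcal G_k^v(\tau)=-\frac{2\pi}{k-1}\sum_{\substack{r+s=k-2\\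 r,s\ge0}}G_{r,s}^v(\tau)\,(X-\tau Y)^r(X-\bar\tau Y)^s .$$ Moreover $\mathcal G_k^v$ is the one and only equivariant primitive of $G_k^v$: it is the unique real-differentiable function $F$ from $\mathbb H$ to the homogeneous polynomials of degree $k-2$ in $\mathbb C[X,Y]$ such that $dF=\operatorname{Re}\underline{G_k^v}$ and $F(\gamma\tau)|_\gamma=F(\tau)$ for all $\gamma\in\Gamma(N)$, $\tau\in\mathbb H$, where $P|_\gamma=P(\alpha X+\beta Y,\alpha'X+\beta'Y)$ for $\gamma=\begin{pmatrix}\alpha&\beta\\ \alpha'&\beta'\end{pmatrix}$. -/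

import Mathlib

open scoped MatrixGroups UpperHalfPlane
open UpperHalfPlane (ofComplex)

noncomputable section

namespace EquivPrim

/-- Polynomials in the two variables `X` (index `0`) and `Y` (index `1`). The space `V_n` consists
of those that satisfy `MvPolynomial.IsHomogeneous P n`. -/
abbrev Poly : Type := MvPolynomial (Fin 2) ℂ

/-- The variable `X`. -/
def X : Poly := MvPolynomial.X 0

/-- The variable `Y`. -/
def Y : Poly := MvPolynomial.X 1

/-- The linear form `X - z Y`. -/
def lin (z : ℂ) : Poly := X - MvPolynomial.C z * Y

/-- The real part of a polynomial: conjugation acts on the coefficients only. -/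
def rePoly (P : Poly) : Poly :=
  ∑ s ∈ P.support, MvPolynomial.monomial s (((P.coeff s).re : ℝ) : ℂ)

/-- The right action `P(X, Y)|_γ = P(aX + bY, cX + dY)`. -/
def slash (P : Poly) (γ : SL(2, ℤ)) : Poly :=
  MvPolynomial.aeval
    ![MvPolynomial.C (γ 0 0 : ℂ) * X + MvPolynomial.C (γ 0 1 : ℂ) * Y,
      MvPolynomial.C (γ 1 0 : ℂ) * X + MvPolynomial.C (γ 1 1 : ℂ) * Y] P

/-- The pairs `(m, n) ≠ (0, 0)` of integers that are congruent to `v` modulo `N`. -/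
def latticePts (N : ℕ) (v : ZMod N × ZMod N) : Set (ℤ × ℤ) :=
  {p | p ≠ 0 ∧ (p.1 : ZMod N) = v.1 ∧ (p.2 : ZMod N) = v.2}

/-- The general term `1 / (mτ + n)^k` of the holomorphic Eisenstein series. -/
def eisTerm (k : ℕ) (τ : ℍ) (p : ℤ × ℤ) : ℂ :=
  1 / ((p.1 : ℂ) * (τ : ℂ) + (p.2 : ℂ)) ^ k

/-- The Eisenstein series `G_k^v(τ)` for `Γ(N)`. -/
def eisG (N k : ℕ) (v : ZMod N × ZMod N) (τ : ℍ) : ℂ :=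
  ∑' p : latticePts N v, eisTerm k τ p

/-- The general term `Im τ / ((mτ + n)^(r+1) (m τ̄ + n)^(s+1))` of the non-holomorphic Eisenstein
series. -/
def nonholTerm (r s : ℕ) (τ : ℍ) (p : ℤ × ℤ) : ℂ :=
  (τ.im : ℂ) / (((p.1 : ℂ) * (τ : ℂ) + (p.2 : ℂ)) ^ (r + 1) *
    ((p.1 : ℂ) * (starRingEnd ℂ) (τ : ℂ) + (p.2 : ℂ)) ^ (s + 1))

/-- The non-holomorphic Eisenstein series `G_{r,s}^v(τ)` for `Γ(N)`. -/
def nonholG (N r s : ℕ) (v : ZMod N × ZMod N) (τ : ℍ) : ℂ :=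
  ∑' p : latticePts N v, nonholTerm r s τ p

/-- The constant coefficient `a_0` of the Fourier expansion `f = ∑ a_n q_N^n`,
`q_N = exp (2πiτ/N)`. -/
def a0 (N : ℕ) (f : ℍ → ℂ) : ℂ :=
  (UpperHalfPlane.qExpansion (N : ℝ) f).coeff 0

/-- The integrand of `∫_τ^{i∞} (f(z) - a_0) z^p dz` on the vertical ray `z = τ + i t`, `t > 0`. -/
def tailIntegrand (N : ℕ) (f : ℍ → ℂ) (p : ℕ) (τ : ℍ) (t : ℝ) : ℂ :=
  (f (ofComplex ((τ : ℂ) + t * Complex.I)) - a0 N f) * ((τ : ℂ) + t * Complex.I) ^ p * Complex.I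

/-- The regularised integral `∫_τ^{1⃗_∞} f(z) z^p dz` from `τ` to the unit tangent vector at the
infinite cusp: `∫_τ^0 a_0 z^p dz + ∫_τ^{i∞} (f(z) - a_0) z^p dz`. -/
def regIntegral (N : ℕ) (f : ℍ → ℂ) (p : ℕ) (τ : ℍ) : ℂ :=
  -(a0 N f * (τ : ℂ) ^ (p + 1) / ((p : ℂ) + 1)) +
    ∫ t in Set.Ioi (0 : ℝ), tailIntegrand N f p τ t

/-- The regularised integral `∫_{1⃗_∞}^τ 2πi f(z) (X - zY)^(k-2) dz`, with `(X - zY)^(k-2)` expanded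
in powers of `z`. -/
def regPolyIntegral (N k : ℕ) (f : ℍ → ℂ) (τ : ℍ) : Poly :=
  -∑ p ∈ Finset.range (k - 1),
    MvPolynomial.C (2 * (Real.pi : ℂ) * Complex.I * ((k - 2).choose p : ℂ) * (-1) ^ p *
      regIntegral N f p τ) * X ^ (k - 2 - p) * Y ^ p

/-- The polylogarithm `Li_m(z) = ∑_{n ≥ 1} z^n / n^m`. -/
def Li (m : ℕ) (z : ℂ) : ℂ := ∑' n : ℕ, z ^ (n + 1) / ((n : ℂ) + 1) ^ m

/-- Clausen's function: the real (`m` odd) or imaginary (`m` even) part of `Li_m(e^{ix})`. -/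
def Cl (m : ℕ) (x : ℝ) : ℝ :=
  if Odd m then (Li m (Complex.exp (Complex.I * x))).re
  else (Li m (Complex.exp (Complex.I * x))).im

/-- The number `A_{ξ_k^u}`, `u = (a, b)`. The exponent `(k + 1) / 2` is `⌈k/2⌉`. -/
def Axi (N k : ℕ) (u : ZMod N × ZMod N) : ℝ :=
  if u.1 = 0 then
    (-1) ^ (k - 1 + (k + 1) / 2) * ((k - 2).factorial / (2 * Real.pi) ^ (k - 2)) *
      Cl (k - 1) (2 * Real.pi * u.2.val / N)
  else 0

/-- The pairing `(u|v) = m d - n c` of `u = (m, n)` and `v = (c, d)`, computed on the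
representatives in `{0, …, N - 1}`; it matters only modulo `N`. -/
def pairing (N : ℕ) (u v : ZMod N × ZMod N) : ℤ :=
  (u.1.val : ℤ) * (v.2.val : ℤ) - (u.2.val : ℤ) * (v.1.val : ℤ)

/-- The number `A_{G_k^v}`. The exponent `k / 2` is `⌊k/2⌋`. -/
def AG (N k : ℕ) [NeZero N] (v : ZMod N × ZMod N) : ℝ :=
  (-1) ^ (k / 2) * (2 * Real.pi) ^ k / ((N : ℝ) ^ 2 * (k - 1).factorial) *
    ∑ u : ZMod N × ZMod N, Axi N k u *
      (if Even k then Real.cos (2 * Real.pi * pairing N u v / N)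
        else Real.sin (2 * Real.pi * pairing N u v / N))

/-- The polynomial `P_{G_k^v} = A_{G_k^v} Y^(k-2)`. -/
def PG (N k : ℕ) [NeZero N] (v : ZMod N × ZMod N) : Poly :=
  MvPolynomial.C (AG N k v : ℂ) * Y ^ (k - 2)

/-- The function `𝒢_k^v(τ) = P_{G_k^v} + Re ∫_{1⃗_∞}^τ 2πi G_k^v(z) (X - zY)^(k-2) dz`. -/
def calG (N k : ℕ) [NeZero N] (v : ZMod N × ZMod N) (τ : ℍ) : Poly :=
  PG N k v + rePoly (regPolyIntegral N k (eisG N k v) τ)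

/-- `F : ℍ → V_{k-2}` is a `Γ(N)`-equivariant solution of
`dF(τ) = Re (2πi f(τ) (X - τY)^(k-2) dτ)`. The differential is taken coefficient by coefficient,
over `ℝ`; on a tangent vector `w` it is `Re (2πi f(τ) (X - τY)^(k-2) w)`. -/
structure IsEquivariantPrimitive (N k : ℕ) (f : ℍ → ℂ) (F : ℍ → Poly) : Prop where
  homogeneous : ∀ τ, (F τ).IsHomogeneous (k - 2)
  equivariant : ∀ γ ∈ CongruenceSubgroup.Gamma N, ∀ τ : ℍ, slash (F (γ • τ)) γ = F τ
  hasDeriv : ∀ (τ : ℍ) (s : Fin 2 →₀ ℕ),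
    HasFDerivAt (𝕜 := ℝ) (fun z : ℂ => (F (ofComplex z)).coeff s)
      (Complex.ofRealCLM.comp (Complex.reCLM.comp
        ((2 * (Real.pi : ℂ) * Complex.I * f τ * (lin (τ : ℂ) ^ (k - 2)).coeff s) •
          ContinuousLinearMap.id ℝ ℂ)))
      (τ : ℂ)

end EquivPrim

end

namespace EquivPrim

open Complex Filter Topology

/-! ### Lattice sums -/

/-! Put n = k - 2. A homogeneous polynomial of degree n is determined by its values at (z, 1) with z
not real, and its coefficients are fixed linear combinations of such values
(`exists_coeff_eq_sum_ev`). The polynomial identities thus reduce to scalar ones, and taking real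
parts of coefficients replaces P(z) by the mean of P(z) and the conjugate of P(z̄) (`ev_rePoly`).
One function governs both sides: the Eichler integral ψ(z, t) = ∑ ((z - t)/(mt + l))^(n+1) / (mz +
l), summed over the lattice points (m, l), whose t-derivative is -(n+1)(z - t)^n G_k^v(t)
(`hasDerivAt_psi`).

On the non-holomorphic side, the sum over r + s = n is, for each lattice point, a finite geometric
sum (`sum_nonholTerm`). Its value at (z, 1) is therefore -(πi/(n+1)) times ψ(z, τ) minus the
conjugate of ψ(z̄, τ) (`ev_nonholPoly`), which gives the differential. Equivariance holds because
Γ(N) permutes the lattice points of a class and the linear forms absorb the automorphy factors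
(`nonholPoly_equivariant`). Two primitives differ by a constant Γ(N)-invariant polynomial, and for n
≥ 1 only zero is invariant (`eq_zero_of_slash_eq`).

On the integral side, ψ(z, t) - a_0 (z - t)^(n+1) is, up to the factor -(n+1), a primitive of (G_k^v
- a_0)(z - t)^n, so the regularised integral is ψ(z, τ) minus a constant determined at the cusp
(`sum_regIntegral`). That constant is computed row by row: the row m = 0 gives a_0 (z - t)^(n+1),
while partial fractions reduce a row m ≠ 0 to a difference of cotangents with an exponentially small
error (`exists_bound_psi`). In the real part, the a_0 term drops out because a_0 is real and the
cotangents in z cancel against their conjugates. What remains is a sum of sign(m)/m^(n+1) over a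
residue class, which Fourier inversion on ℤ/N identifies with the Clausen expression (`AG_eq`,
`psiLimit_sub_conj`). Hence both sides have the same values (`calG_eq_nonholPoly`). -/

lemma norm_vec_eq_norm_prod (p : ℤ × ℤ) : ‖(![p.1, p.2] : Fin 2 → ℤ)‖ = ‖p‖ := by
  simp [EisensteinSeries.norm_eq_max_natAbs, Prod.norm_def, Int.norm_eq_abs]

/-- The bound at the corner A + iB of the strip serves for the whole strip. Uniformity in t is what
allows termwise differentiation of lattice sums. -/
lemma exists_lower_bound_strip (A : ℝ) {B : ℝ} (hB : 0 < B) :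
    ∃ r > 0, ∀ t : ℂ, |t.re| ≤ A → B ≤ t.im → ∀ p : ℤ × ℤ, r * ‖p‖ ≤ ‖(p.1 : ℂ) * t + p.2‖ := by
  refine ⟨EisensteinSeries.r ⟨⟨A, B⟩, hB⟩, EisensteinSeries.r_pos _, fun t ht ht' p => ?_⟩
  rcases eq_or_ne p 0 with rfl | hp
  · simp
  have ht0 : 0 < t.im := hB.trans_le ht'
  have hx : (![p.1, p.2] : Fin 2 → ℤ) ≠ 0 := by
    intro h
    apply hp
    ext
    · simpa using congrFun h 0
    · simpa using congrFun h 1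
  have h1 := EisensteinSeries.r_mul_max_le ⟨t, ht0⟩ hx
  have h2 := EisensteinSeries.r_lower_bound_on_verticalStrip ⟨t, ht0⟩ (A := A) hB ⟨ht, ht'⟩
  rw [norm_vec_eq_norm_prod] at h1
  refine le_trans (mul_le_mul_of_nonneg_right h2 (norm_nonneg p)) ?_
  simpa using h1

/-- Conjugation carries the lower half-plane to the upper one. Both are needed, since `psi` is used
at z and at its conjugate. -/
lemma exists_lower_bound {z : ℂ} (hz : z.im ≠ 0) :
    ∃ r > 0, ∀ p : ℤ × ℤ, r * ‖p‖ ≤ ‖(p.1 : ℂ) * z + p.2‖ := by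
  rcases lt_or_gt_of_ne hz with h | h
  · obtain ⟨r, hr, H⟩ := exists_lower_bound_strip |z.re| (B := -z.im) (by linarith)
    refine ⟨r, hr, fun p => ?_⟩
    have := H ((starRingEnd ℂ) z) (by simp) (by simp) p
    rwa [← Complex.norm_conj ((p.1 : ℂ) * z + p.2), map_add, map_mul, map_intCast, map_intCast]
  · obtain ⟨r, hr, H⟩ := exists_lower_bound_strip |z.re| h
    exact ⟨r, hr, H z le_rfl le_rfl⟩

lemma linear_ne_zero {z : ℂ} (hz : z.im ≠ 0) {p : ℤ × ℤ} (hp : p ≠ 0) :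
    (p.1 : ℂ) * z + p.2 ≠ 0 := by
  obtain ⟨r, hr, H⟩ := exists_lower_bound hz
  have := H p
  have h2 : 0 < r * ‖p‖ := mul_pos hr (norm_pos_iff.mpr hp)
  exact norm_pos_iff.mp (h2.trans_le this)

lemma summable_inv_norm_pow {k : ℕ} (hk : 3 ≤ k) :
    Summable fun p : ℤ × ℤ => (‖p‖ ^ k)⁻¹ := by
  have h := EisensteinSeries.summable_one_div_norm_rpow (k := (k : ℝ)) (by exact_mod_cast hk)
  rw [← (finTwoArrowEquiv ℤ).symm.summable_iff] at h
  refine h.congr fun p => ?_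
  simp [Real.rpow_neg, norm_vec_eq_norm_prod]

/-! ### The Eichler integral ψ and its derivative -/

/-- The general term of the series whose derivative is the Eisenstein series times a power of
`z - t`. -/
noncomputable def psiTerm (n : ℕ) (z t : ℂ) (p : ℤ × ℤ) : ℂ :=
  ((z - t) / ((p.1 : ℂ) * t + p.2)) ^ (n + 1) / ((p.1 : ℂ) * z + p.2)

/-- An Eichler integral of the Eisenstein series of weight `n + 2`. -/
noncomputable def psi (N n : ℕ) (v : ZMod N × ZMod N) (z t : ℂ) : ℂ :=
  ∑' p : latticePts N v, psiTerm n z t p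

/-- The derivative of (z - t)/(mt + l) is -(mz + l)/(mt + l)^2. Its numerator cancels the
denominator of `psiTerm`, so that z enters the result only through a factor common to all lattice
points. -/
lemma hasDerivAt_psiTerm (n : ℕ) {z t : ℂ} (hz : z.im ≠ 0) (ht : t.im ≠ 0) {p : ℤ × ℤ}
    (hp : p ≠ 0) :
    HasDerivAt (fun t => psiTerm n z t p)
      (-((n : ℂ) + 1) * (z - t) ^ n * (1 / ((p.1 : ℂ) * t + p.2) ^ (n + 2))) t := by
  have h1 := linear_ne_zero ht hp
  have h2 := linear_ne_zero hz hp
  have hd : HasDerivAt (fun t : ℂ => (z - t) / ((p.1 : ℂ) * t + p.2))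
      (((-1) * ((p.1 : ℂ) * t + p.2) - (z - t) * p.1) / ((p.1 : ℂ) * t + p.2) ^ 2) t := by
    have e1 : HasDerivAt (fun t : ℂ => z - t) (-1) t := by
      simpa using (hasDerivAt_id t).const_sub z
    have e2 : HasDerivAt (fun t : ℂ => (p.1 : ℂ) * t + p.2) (p.1 : ℂ) t := by
      simpa using ((hasDerivAt_id t).const_mul (p.1 : ℂ)).add_const (p.2 : ℂ)
    exact e1.div e2 h1
  have := (hd.pow (n + 1)).div_const ((p.1 : ℂ) * z + p.2)
  refine this.congr_deriv ?_
  have e : (-1) * ((p.1 : ℂ) * t + p.2) - (z - t) * p.1 = -((p.1 : ℂ) * z + p.2) := by ring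
  rw [e]
  simp only [Nat.add_sub_cancel, div_pow]
  push_cast
  generalize (p.1 : ℂ) * t + p.2 = w at *
  generalize (p.1 : ℂ) * z + p.2 = w' at *
  field_simp
  ring

lemma norm_psiTerm_le (n : ℕ) {z t : ℂ} {r s D : ℝ} (hr : 0 < r) (hs : 0 < s) {p : ℤ × ℤ}
    (hp : p ≠ 0) (h1 : r * ‖p‖ ≤ ‖(p.1 : ℂ) * t + p.2‖) (h2 : s * ‖p‖ ≤ ‖(p.1 : ℂ) * z + p.2‖)
    (hD : ‖z - t‖ ≤ D) : ‖psiTerm n z t p‖ ≤ (D / r) ^ (n + 1) / s * (‖p‖ ^ (n + 2))⁻¹ := by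
  have hp' : 0 < ‖p‖ := norm_pos_iff.mpr hp
  have hD0 : 0 ≤ D := (norm_nonneg _).trans hD
  rw [psiTerm, norm_div, norm_pow, norm_div]
  calc _ ≤ (D / (r * ‖p‖)) ^ (n + 1) / (s * ‖p‖) := by gcongr
    _ = _ := by
      rw [div_pow, div_pow, mul_pow, pow_succ ‖p‖ (n + 1)]
      field_simp

lemma differentiableOn_and_hasSum_psi {N n : ℕ} (hn : 1 ≤ n) (v : ZMod N × ZMod N) {z t : ℂ}
    (hz : z.im ≠ 0) (ht : 0 < t.im) :
    Summable (fun p : latticePts N v => psiTerm n z t p) ∧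
    DifferentiableAt ℂ (psi N n v z) t ∧
    HasSum (fun p : latticePts N v =>
      (-((n : ℂ) + 1) * (z - t) ^ n * (1 / (((p : ℤ × ℤ).1 : ℂ) * t + (p : ℤ × ℤ).2) ^ (n + 2))))
      (deriv (psi N n v z) t) := by
  obtain ⟨r, hr, H⟩ := exists_lower_bound_strip (|t.re| + t.im / 2) (B := t.im / 2) (by linarith)
  obtain ⟨s, hs, H'⟩ := exists_lower_bound hz
  -- On this disc the imaginary part stays at least half that of t, so one summable majorant works
  -- for all its points.
  set U := Metric.ball t (t.im / 2) with hU
  have hUt : ∀ w ∈ U, |w.re| ≤ |t.re| + t.im / 2 ∧ t.im / 2 ≤ w.im ∧ ‖w - t‖ ≤ t.im / 2 := by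
    intro w hw
    rw [hU, Metric.mem_ball, dist_eq_norm] at hw
    have h1 := (abs_re_le_norm (w - t)).trans hw.le
    have h2 := (abs_im_le_norm (w - t)).trans hw.le
    rw [sub_re] at h1
    rw [sub_im] at h2
    refine ⟨?_, ?_, hw.le⟩
    · have := abs_sub_abs_le_abs_sub w.re t.re
      linarith
    · have := (abs_le.mp h2).1
      linarith
  have htU : t ∈ U := Metric.mem_ball_self (by linarith)
  have hb : ∀ (p : latticePts N v) (w : ℂ), w ∈ U → ‖psiTerm n z w p‖ ≤
      ((‖z - t‖ + t.im / 2) / r) ^ (n + 1) / s * (‖(p : ℤ × ℤ)‖ ^ (n + 2))⁻¹ := by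
    intro p w hw
    obtain ⟨h1, h2, h3⟩ := hUt w hw
    refine norm_psiTerm_le n hr hs p.2.1 (H w h1 h2 p) (H' p) ?_
    calc ‖z - w‖ = ‖(z - t) - (w - t)‖ := by ring_nf
      _ ≤ _ := (norm_sub_le _ _).trans (by linarith)
  have hsum : Summable (fun p : latticePts N v =>
      ((‖z - t‖ + t.im / 2) / r) ^ (n + 1) / s * (‖(p : ℤ × ℤ)‖ ^ (n + 2))⁻¹) :=
    ((summable_inv_norm_pow (k := n + 2) (by omega)).subtype _).mul_left _
  have hdiff : ∀ p : latticePts N v, DifferentiableOn ℂ (fun w => psiTerm n z w p) U := by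
    intro p w hw
    exact (hasDerivAt_psiTerm n hz (by have := (hUt w hw).2.1; intro h; linarith)
      p.2.1).differentiableAt.differentiableWithinAt
  refine ⟨Summable.of_norm_bounded hsum fun p => hb p t htU, ?_, ?_⟩
  · exact (differentiableOn_tsum_of_summable_norm hsum hdiff Metric.isOpen_ball hb).differentiableAt
      (Metric.isOpen_ball.mem_nhds htU)
  · refine (hasSum_deriv_of_summable_norm hsum hdiff Metric.isOpen_ball hb htU).congr_fun ?_
    exact fun p => (hasDerivAt_psiTerm n hz ht.ne' p.2.1).deriv.symm

/-- The Eisenstein series as a function of a complex variable. -/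
noncomputable def eisC (N n : ℕ) (v : ZMod N × ZMod N) (t : ℂ) : ℂ :=
  ∑' p : latticePts N v, 1 / (((p : ℤ × ℤ).1 : ℂ) * t + (p : ℤ × ℤ).2) ^ (n + 2)

lemma eisG_eq_eisC (N n : ℕ) (v : ZMod N × ZMod N) (τ : ℍ) :
    eisG N (n + 2) v τ = eisC N n v τ := rfl

lemma eisG_ofComplex (N n : ℕ) (v : ZMod N × ZMod N) {t : ℂ} (ht : 0 < t.im) :
    eisG N (n + 2) v (ofComplex t) = eisC N n v t := by
  rw [eisG_eq_eisC, UpperHalfPlane.ofComplex_apply_of_im_pos ht]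

lemma summable_inv_linear_pow {k : ℕ} (hk : 3 ≤ k) {z : ℂ} (hz : z.im ≠ 0) :
    Summable fun p : ℤ × ℤ => 1 / ((p.1 : ℂ) * z + p.2) ^ k := by
  obtain ⟨r, hr, H⟩ := exists_lower_bound hz
  refine Summable.of_norm_bounded ((summable_inv_norm_pow hk).mul_left (1 / r ^ k)) fun p => ?_
  rcases eq_or_ne p 0 with rfl | hp
  · simp [show k ≠ 0 by omega]
  have hp' : 0 < ‖p‖ := norm_pos_iff.mpr hp
  rw [norm_div, norm_one, norm_pow]
  calc _ ≤ 1 / (r * ‖p‖) ^ k := by gcongr; exact H p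
    _ = _ := by rw [mul_pow, one_div, one_div, mul_inv]

lemma hasDerivAt_psi {N n : ℕ} (hn : 1 ≤ n) (v : ZMod N × ZMod N) {z t : ℂ}
    (hz : z.im ≠ 0) (ht : 0 < t.im) :
    HasDerivAt (psi N n v z) (-((n : ℂ) + 1) * (z - t) ^ n * eisC N n v t) t := by
  obtain ⟨-, h1, h2⟩ := differentiableOn_and_hasSum_psi hn v hz ht
  refine h1.hasDerivAt.congr_deriv ?_
  rw [eisC, ← tsum_mul_left]
  exact h2.tsum_eq.symm

/-- No further estimate is needed: the series is the derivative of the holomorphic function `psi`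
divided by -(n+1)(z - t)^n, which has no zero in the upper half-plane when z = -i. -/
lemma differentiableOn_eisC {N n : ℕ} (hn : 1 ≤ n) (v : ZMod N × ZMod N) :
    DifferentiableOn ℂ (eisC N n v) {t | 0 < t.im} := by
  have ho : IsOpen {t : ℂ | 0 < t.im} := isOpen_lt continuous_const continuous_im
  have hz : (-I : ℂ).im ≠ 0 := by simp
  have hd : DifferentiableOn ℂ (psi N n v (-I)) {t | 0 < t.im} := fun t ht =>
    (hasDerivAt_psi hn v hz ht).differentiableAt.differentiableWithinAt
  have hne : ∀ t : ℂ, 0 < t.im → -((n : ℂ) + 1) * (-I - t) ^ n ≠ 0 := by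
    intro t ht
    refine mul_ne_zero (neg_ne_zero.mpr (by exact_mod_cast Nat.succ_ne_zero n)) (pow_ne_zero _ ?_)
    intro h
    have := congrArg Complex.im h
    simp at this
    linarith
  refine ((hd.deriv ho).div (c := deriv (psi N n v (-I)))
    (d := fun t => -((n : ℂ) + 1) * (-I - t) ^ n) (by fun_prop) hne).congr fun t ht => ?_
  rw [Pi.div_apply, (hasDerivAt_psi hn v hz ht).deriv, mul_div_cancel_left₀ _ (hne t ht)]

/-! ### Homogeneous polynomials and their values at `(z, 1)` -/

/-- Evaluation at `X = z`, `Y = 1`. -/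
noncomputable def ev (z : ℂ) : Poly →+* ℂ := MvPolynomial.eval ![z, 1]

@[simp] lemma ev_C (z a : ℂ) : ev z (MvPolynomial.C a) = a := by simp [ev]

@[simp] lemma ev_X (z : ℂ) : ev z X = z := by simp [ev, X]

@[simp] lemma ev_Y (z : ℂ) : ev z Y = 1 := by simp [ev, Y]

@[simp] lemma ev_lin (z t : ℂ) : ev z (lin t) = z - t := by simp [lin]

lemma coeff_rePoly (P : Poly) (s : Fin 2 →₀ ℕ) :
    (rePoly P).coeff s = (((P.coeff s).re : ℝ) : ℂ) := by
  classical
  rw [rePoly, MvPolynomial.coeff_sum]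
  simp only [MvPolynomial.coeff_monomial]
  rw [Finset.sum_ite_eq']
  split_ifs with h
  · rfl
  · rw [MvPolynomial.notMem_support_iff.mp h]
    simp

lemma rePoly_eq (P : Poly) :
    rePoly P = MvPolynomial.C (1 / 2) * (P + MvPolynomial.map (starRingEnd ℂ) P) := by
  ext s
  rw [coeff_rePoly, MvPolynomial.coeff_C_mul, MvPolynomial.coeff_add, MvPolynomial.coeff_map,
    Complex.re_eq_add_conj]
  ring

lemma ev_map_conj (z : ℂ) (P : Poly) :
    ev z (MvPolynomial.map (starRingEnd ℂ) P) = (starRingEnd ℂ) (ev ((starRingEnd ℂ) z) P) := by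
  rw [ev, ev, MvPolynomial.map_eval]
  congr 2
  ext i
  fin_cases i <;> simp

lemma ev_rePoly (z : ℂ) (P : Poly) :
    ev z (rePoly P) = (ev z P + (starRingEnd ℂ) (ev ((starRingEnd ℂ) z) P)) / 2 := by
  rw [rePoly_eq, map_mul, map_add, ev_map_conj, ev_C]
  ring

lemma isHomogeneous_lin (t : ℂ) : (lin t).IsHomogeneous 1 := by
  refine (MvPolynomial.isHomogeneous_X ℂ 0).sub ?_
  have := (MvPolynomial.isHomogeneous_C (Fin 2) t).mul (MvPolynomial.isHomogeneous_X ℂ 1)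
  rwa [zero_add] at this

lemma isHomogeneous_rePoly {P : Poly} {n : ℕ} (hP : P.IsHomogeneous n) :
    (rePoly P).IsHomogeneous n := by
  intro s hs
  apply hP
  rw [coeff_rePoly] at hs
  intro h
  simp [h] at hs

/-- Dehomogenization. -/
noncomputable def dehom : Poly →ₐ[ℂ] Polynomial ℂ := MvPolynomial.aeval ![Polynomial.X, 1]

lemma eval_dehom (z : ℂ) (P : Poly) : (dehom P).eval z = ev z P := by
  have : (Polynomial.evalRingHom z).comp (dehom : Poly →+* Polynomial ℂ) = ev z := by
    apply MvPolynomial.ringHom_ext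
    · intro a
      simp [dehom, ev]
    · intro i
      fin_cases i <;> simp [dehom, ev]
  exact congrArg (fun f : Poly →+* ℂ => f P) this

lemma dehom_monomial (s : Fin 2 →₀ ℕ) (a : ℂ) :
    dehom (MvPolynomial.monomial s a) = Polynomial.monomial (s 0) a := by
  rw [dehom, MvPolynomial.aeval_monomial, Finsupp.prod_fintype _ _ (by simp)]
  simp [Polynomial.C_mul_X_pow_eq_monomial]

/-- In a fixed degree the exponent of X determines that of Y, so setting Y = 1 does not merge
monomials. -/
lemma coeff_dehom {P : Poly} {n : ℕ} (hP : P.IsHomogeneous n) {s : Fin 2 →₀ ℕ}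
    (hs : s 0 + s 1 = n) : (dehom P).coeff (s 0) = P.coeff s := by
  classical
  conv_lhs => rw [P.as_sum, map_sum, Polynomial.finsetSum_coeff]
  simp only [dehom_monomial, Polynomial.coeff_monomial]
  rw [Finset.sum_eq_single s]
  · simp
  · intro t ht hts
    rw [if_neg]
    intro h0
    apply hts
    have h1 := hP (MvPolynomial.mem_support_iff.mp ht)
    rw [Finsupp.weight_apply, Finsupp.sum_fintype _ _ (by simp)] at h1
    simp at h1
    ext i
    fin_cases i
    · exact h0
    · change t 1 = s 1
      omega
  · intro h
    simp [MvPolynomial.notMem_support_iff.mp h]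

lemma degree_dehom_lt {P : Poly} {n : ℕ} (hP : P.IsHomogeneous n) :
    (dehom P).degree < (n + 1 : ℕ) := by
  rw [P.as_sum, map_sum]
  refine (Polynomial.degree_sum_le _ _).trans_lt ?_
  rw [Finset.sup_lt_iff (by exact WithBot.bot_lt_coe _)]
  intro t ht
  rw [dehom_monomial]
  refine (Polynomial.degree_monomial_le _ _).trans_lt ?_
  have h1 := hP (MvPolynomial.mem_support_iff.mp ht)
  rw [Finsupp.weight_apply, Finsupp.sum_fintype _ _ (by simp)] at h1
  simp at h1
  exact_mod_cast (by omega : t 0 < n + 1)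

lemma coeff_eq_zero_of_homogeneous {P : Poly} {n : ℕ} (hP : P.IsHomogeneous n) {s : Fin 2 →₀ ℕ}
    (hs : s 0 + s 1 ≠ n) : P.coeff s = 0 := by
  by_contra h
  have h1 := hP h
  rw [Finsupp.weight_apply, Finsupp.sum_fintype _ _ (by simp)] at h1
  simp at h1
  exact hs h1

/-- The coefficients of a homogeneous polynomial are fixed linear combinations of its values at
points `(z, 1)` with `z` not real. -/
lemma exists_coeff_eq_sum_ev (n : ℕ) (s : Fin 2 →₀ ℕ) : ∃ c : ℕ → ℂ, ∀ P : Poly,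
    P.IsHomogeneous n → P.coeff s = ∑ i ∈ Finset.range (n + 1), c i * ev ((i : ℂ) + I) P := by
  by_cases hs : s 0 + s 1 = n
  -- Lagrange interpolation of P(x, 1), of degree at most n, at n + 1 distinct nodes of imaginary
  -- part 1. The basis polynomials do not depend on P.
  · refine ⟨fun i => (Lagrange.basis (Finset.range (n + 1)) (fun i : ℕ => (i : ℂ) + I) i).coeff
      (s 0), fun P hP => ?_⟩
    have hinj : Set.InjOn (fun i : ℕ => (i : ℂ) + I) (Finset.range (n + 1)) := by
      intro i _ j _ h
      simpa using h
    have h := Lagrange.eq_interpolate (f := dehom P) hinj (by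
      simpa using degree_dehom_lt hP)
    rw [← coeff_dehom hP hs, h, Lagrange.interpolate_apply, Polynomial.finsetSum_coeff]
    refine Finset.sum_congr rfl fun i _ => ?_
    rw [Polynomial.coeff_C_mul, eval_dehom, mul_comm]
  · exact ⟨0, fun P hP => by simp [coeff_eq_zero_of_homogeneous hP hs]⟩

lemma eq_of_ev_eq {P Q : Poly} {n : ℕ} (hP : P.IsHomogeneous n) (hQ : Q.IsHomogeneous n)
    (h : ∀ z : ℂ, z.im ≠ 0 → ev z P = ev z Q) : P = Q := by
  ext s
  obtain ⟨c, hc⟩ := exists_coeff_eq_sum_ev n s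
  rw [hc P hP, hc Q hQ]
  exact Finset.sum_congr rfl fun i _ => by rw [h _ (by simp)]

/-! ### The non-holomorphic side -/

/-- The combination of non-holomorphic Eisenstein series of weight `n + 2`. -/
noncomputable def nonholPoly (N n : ℕ) (v : ZMod N × ZMod N) (τ : ℍ) : Poly :=
  MvPolynomial.C (-(2 * (Real.pi : ℂ) / ((n : ℂ) + 1))) *
    ∑ rs ∈ Finset.HasAntidiagonal.antidiagonal n,
      MvPolynomial.C (nonholG N rs.1 rs.2 v τ) *
        lin (τ : ℂ) ^ rs.1 * lin ((starRingEnd ℂ) (τ : ℂ)) ^ rs.2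

lemma isHomogeneous_nonholPoly (N n : ℕ) (v : ZMod N × ZMod N) (τ : ℍ) :
    (nonholPoly N n v τ).IsHomogeneous n := by
  have := (MvPolynomial.isHomogeneous_C (Fin 2) (-(2 * (Real.pi : ℂ) / ((n : ℂ) + 1)))).mul
    (MvPolynomial.IsHomogeneous.sum (Finset.HasAntidiagonal.antidiagonal n) (fun rs =>
      MvPolynomial.C (nonholG N rs.1 rs.2 v τ) *
        lin (τ : ℂ) ^ rs.1 * lin ((starRingEnd ℂ) (τ : ℂ)) ^ rs.2) n (fun rs hrs => by
      have h := ((MvPolynomial.isHomogeneous_C (Fin 2) (nonholG N rs.1 rs.2 v τ)).mul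
        ((isHomogeneous_lin (τ : ℂ)).pow rs.1)).mul
        ((isHomogeneous_lin ((starRingEnd ℂ) (τ : ℂ))).pow rs.2)
      rw [Finset.HasAntidiagonal.mem_antidiagonal] at hrs
      simpa [hrs] using h))
  simpa [nonholPoly] using this

lemma norm_nonholTerm (r s : ℕ) (τ : ℍ) (p : ℤ × ℤ) :
    ‖nonholTerm r s τ p‖ = τ.im * ‖1 / ((p.1 : ℂ) * τ + p.2) ^ (r + s + 2)‖ := by
  have h : (p.1 : ℂ) * (starRingEnd ℂ) (τ : ℂ) + p.2
      = (starRingEnd ℂ) ((p.1 : ℂ) * (τ : ℂ) + p.2) := by simp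
  rw [nonholTerm, h]
  simp only [norm_div, norm_mul, norm_pow, Complex.norm_conj, norm_one]
  rw [Complex.norm_real, Real.norm_of_nonneg τ.im_pos.le, ← pow_add]
  rw [mul_one_div]
  congr 2
  ring

lemma summable_nonholTerm {N r s : ℕ} (h : 1 ≤ r + s) (v : ZMod N × ZMod N) (τ : ℍ) :
    Summable fun p : latticePts N v => nonholTerm r s τ p := by
  have h1 := (summable_inv_linear_pow (k := r + s + 2) (by omega) τ.im_ne_zero).norm.mul_left τ.im
  refine Summable.of_norm ((h1.subtype (latticePts N v)).congr fun p => ?_)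
  exact (norm_nonholTerm r s τ p.1).symm

lemma conj_psiTerm (n : ℕ) (z t : ℂ) (p : ℤ × ℤ) :
    (starRingEnd ℂ) (psiTerm n ((starRingEnd ℂ) z) t p) =
      ((z - (starRingEnd ℂ) t) / ((p.1 : ℂ) * (starRingEnd ℂ) t + p.2)) ^ (n + 1) /
        ((p.1 : ℂ) * z + p.2) := by
  simp [psiTerm]

/-- With w = mτ + l, w' = mτ̄ + l, a = (z - τ)/w and b = (z - τ̄)/w', the left side is Im τ/(ww')
times the geometric sum (a^(n+1) - b^(n+1))/(a - b). Since a - b = -2i Im τ (mz + l)/(ww'), the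
factors Im τ and ww' cancel. -/
lemma sum_nonholTerm (n : ℕ) {z : ℂ} (hz : z.im ≠ 0) (τ : ℍ) {p : ℤ × ℤ} (hp : p ≠ 0) :
    ∑ rs ∈ Finset.HasAntidiagonal.antidiagonal n, nonholTerm rs.1 rs.2 τ p *
      (z - τ) ^ rs.1 * (z - (starRingEnd ℂ) (τ : ℂ)) ^ rs.2 =
    I / 2 * (psiTerm n z τ p - (starRingEnd ℂ) (psiTerm n ((starRingEnd ℂ) z) τ p)) := by
  rw [conj_psiTerm, psiTerm]
  have h1 := linear_ne_zero τ.im_ne_zero hp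
  have h2 := linear_ne_zero (z := (starRingEnd ℂ) (τ : ℂ)) (by simpa using τ.im_ne_zero) hp
  have h3 := linear_ne_zero hz hp
  have hy : (τ.im : ℂ) ≠ 0 := by exact_mod_cast τ.im_ne_zero
  have hconj : (τ : ℂ) - (starRingEnd ℂ) (τ : ℂ) = 2 * τ.im * I := by
    rw [Complex.sub_conj]; simp
  set w := (p.1 : ℂ) * τ + p.2 with hw
  set w' := (p.1 : ℂ) * (starRingEnd ℂ) (τ : ℂ) + p.2 with hw'
  set a := (z - τ) / w with ha
  set b := (z - (starRingEnd ℂ) (τ : ℂ)) / w' with hb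
  have hab : (a - b) * (w * w') = -(2 * τ.im * I) * ((p.1 : ℂ) * z + p.2) := by
    rw [← hconj]
    have e1 : a * w = z - τ := div_mul_cancel₀ _ h1
    have e2 : b * w' = z - (starRingEnd ℂ) (τ : ℂ) := div_mul_cancel₀ _ h2
    calc (a - b) * (w * w') = (a * w) * w' - (b * w') * w := by ring
      _ = _ := by rw [e1, e2, hw, hw']; ring
  have hgeom := (Commute.all a b).mul_geom_sum₂ (n + 1)
  rw [Finset.Nat.sum_antidiagonal_eq_sum_range_succ_mk]
  have hterm : ∀ i ∈ Finset.range (n + 1), nonholTerm i (n - i) τ p * (z - τ) ^ i *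
      (z - (starRingEnd ℂ) (τ : ℂ)) ^ (n - i) =
      τ.im / (w * w') * (a ^ i * b ^ (n + 1 - 1 - i)) := by
    intro i _
    rw [nonholTerm, ← hw, ← hw', ha, hb, div_pow, div_pow, Nat.add_sub_cancel]
    field_simp
    ring
  rw [Finset.sum_congr rfl hterm, ← Finset.mul_sum]
  set S := ∑ i ∈ Finset.range (n + 1), a ^ i * b ^ (n + 1 - 1 - i) with hS
  rw [← sub_div, ← hgeom]
  have hab' : a - b = -(2 * τ.im * I) * ((p.1 : ℂ) * z + p.2) / (w * w') :=
    eq_div_of_mul_eq (mul_ne_zero h1 h2) hab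
  rw [hab']
  have hI : I * I = -1 := I_mul_I
  field_simp
  linear_combination S * hI

lemma im_conj_ne_zero {z : ℂ} (hz : z.im ≠ 0) : ((starRingEnd ℂ) z).im ≠ 0 := by
  simpa using hz

lemma ev_nonholPoly {N n : ℕ} (hn : 1 ≤ n) (v : ZMod N × ZMod N) {z : ℂ} (hz : z.im ≠ 0) (τ : ℍ) :
    ev z (nonholPoly N n v τ) = -(Real.pi * I / ((n : ℂ) + 1)) *
      (psi N n v z τ - (starRingEnd ℂ) (psi N n v ((starRingEnd ℂ) z) τ)) := by
  have hs1 := (differentiableOn_and_hasSum_psi hn v hz τ.im_pos).1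
  have hs2 := (differentiableOn_and_hasSum_psi hn v (im_conj_ne_zero hz) τ.im_pos).1
  have key : ∑ rs ∈ Finset.HasAntidiagonal.antidiagonal n, nonholG N rs.1 rs.2 v τ *
      (z - τ) ^ rs.1 * (z - (starRingEnd ℂ) (τ : ℂ)) ^ rs.2 =
      I / 2 * (psi N n v z τ - (starRingEnd ℂ) (psi N n v ((starRingEnd ℂ) z) τ)) := by
    have hs : ∀ rs ∈ Finset.HasAntidiagonal.antidiagonal n,
        Summable fun p : latticePts N v => nonholTerm rs.1 rs.2 τ p *
          (z - τ) ^ rs.1 * (z - (starRingEnd ℂ) (τ : ℂ)) ^ rs.2 := by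
      intro rs hrs
      rw [Finset.HasAntidiagonal.mem_antidiagonal] at hrs
      exact ((summable_nonholTerm (by omega) v τ).mul_right _).mul_right _
    simp only [nonholG, ← tsum_mul_right]
    rw [← Summable.tsum_finsetSum hs, psi, psi, Complex.conj_tsum, ← Summable.tsum_sub hs1,
      ← tsum_mul_left]
    · exact tsum_congr fun p => sum_nonholTerm n hz τ p.2.1
    · exact (Complex.hasSum_conj'.mpr hs2.hasSum).summable
  have : ev z (nonholPoly N n v τ) = -(2 * (Real.pi : ℂ) / ((n : ℂ) + 1)) *
      ∑ rs ∈ Finset.HasAntidiagonal.antidiagonal n, nonholG N rs.1 rs.2 v τ *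
      (z - τ) ^ rs.1 * (z - (starRingEnd ℂ) (τ : ℂ)) ^ rs.2 := by
    simp [nonholPoly, map_sum]
  rw [this, key]
  ring

/-- The value at (z, 1) is a holomorphic function of τ plus an antiholomorphic one, and both
differentials come from `hasDerivAt_psi`. -/
lemma hasFDerivAt_ev_nonholPoly {N n : ℕ} (hn : 1 ≤ n) (v : ZMod N × ZMod N) {z : ℂ}
    (hz : z.im ≠ 0) (τ : ℍ) :
    HasFDerivAt (𝕜 := ℝ) (fun t : ℂ => ev z (nonholPoly N n v (ofComplex t)))
      (-(Real.pi * I / ((n : ℂ) + 1)) •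
        ((-((n : ℂ) + 1) * (z - τ) ^ n * eisC N n v τ) • ContinuousLinearMap.id ℝ ℂ -
        (conjCLE : ℂ →L[ℝ] ℂ).comp ((-((n : ℂ) + 1) * ((starRingEnd ℂ) z - τ) ^ n * eisC N n v τ) •
          ContinuousLinearMap.id ℝ ℂ))) (τ : ℂ) := by
  have hd : ∀ {z : ℂ}, z.im ≠ 0 → HasFDerivAt (𝕜 := ℝ) (psi N n v z)
      ((-((n : ℂ) + 1) * (z - τ) ^ n * eisC N n v τ) • ContinuousLinearMap.id ℝ ℂ) (τ : ℂ) := by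
    intro z hz
    refine ((hasDerivAt_psi hn v hz τ.im_pos).hasFDerivAt.restrictScalars ℝ).congr_fderiv ?_
    ext
    simp [mul_comm]
  have h := ((hd hz).sub ((conjCLE : ℂ →L[ℝ] ℂ).hasFDerivAt.comp (τ : ℂ)
    (hd (im_conj_ne_zero hz)))).const_smul (-(Real.pi * I / ((n : ℂ) + 1)))
  refine h.congr_of_eventuallyEq ?_
  have ho : IsOpen {t : ℂ | 0 < t.im} := isOpen_lt continuous_const continuous_im
  filter_upwards [ho.mem_nhds τ.im_pos] with t ht
  rw [ev_nonholPoly hn v hz, UpperHalfPlane.ofComplex_apply_of_im_pos ht]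
  simp

lemma hasDeriv_nonholPoly {N n : ℕ} (hn : 1 ≤ n) (v : ZMod N × ZMod N) (τ : ℍ)
    (s : Fin 2 →₀ ℕ) :
    HasFDerivAt (𝕜 := ℝ) (fun z : ℂ => (nonholPoly N n v (ofComplex z)).coeff s)
      (Complex.ofRealCLM.comp (Complex.reCLM.comp
        ((2 * (Real.pi : ℂ) * Complex.I * eisC N n v τ * (lin (τ : ℂ) ^ n).coeff s) •
          ContinuousLinearMap.id ℝ ℂ)))
      (τ : ℂ) := by
  obtain ⟨c, hc⟩ := exists_coeff_eq_sum_ev n s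
  have h : HasFDerivAt (𝕜 := ℝ) (fun t : ℂ => ∑ i ∈ Finset.range (n + 1),
      c i • ev ((i : ℂ) + I) (nonholPoly N n v (ofComplex t))) _ (τ : ℂ) :=
    HasFDerivAt.fun_sum fun i _ =>
      (hasFDerivAt_ev_nonholPoly hn v (z := (i : ℂ) + I) (by simp) τ).const_smul (c i)
  have hfun : (fun t : ℂ => (nonholPoly N n v (ofComplex t)).coeff s) =
      fun t : ℂ => ∑ i ∈ Finset.range (n + 1),
      c i • ev ((i : ℂ) + I) (nonholPoly N n v (ofComplex t)) := by
    funext t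
    rw [hc _ (isHomogeneous_nonholPoly N n v _)]
    rfl
  rw [hfun]
  refine h.congr_fderiv ?_
  ext w
  -- `Q` is the expected differential on the tangent vector w, as a homogeneous polynomial.
  -- Expanding its coefficient with the same constants `c` leaves an identity of values at each
  -- node.
  set Q : Poly := rePoly (MvPolynomial.C (2 * (Real.pi : ℂ) * I * eisC N n v τ * w) *
    lin (τ : ℂ) ^ n) with hQ
  have hQh : Q.IsHomogeneous n := by
    apply isHomogeneous_rePoly
    have := (MvPolynomial.isHomogeneous_C (Fin 2)
      (2 * (Real.pi : ℂ) * I * eisC N n v τ * w)).mul ((isHomogeneous_lin (τ : ℂ)).pow n)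
    simpa using this
  have h1 : (Complex.ofRealCLM.comp (Complex.reCLM.comp
        ((2 * (Real.pi : ℂ) * Complex.I * eisC N n v τ * (lin (τ : ℂ) ^ n).coeff s) •
          ContinuousLinearMap.id ℝ ℂ))) w = Q.coeff s := by
    rw [hQ, coeff_rePoly, MvPolynomial.coeff_C_mul]
    simp only [ContinuousLinearMap.comp_apply, smul_apply,
      ContinuousLinearMap.id_apply, smul_eq_mul, reCLM_apply, ofRealCLM_apply]
    congr 2
    ring
  rw [h1, hc Q hQh, sum_apply]
  refine Finset.sum_congr rfl fun i _ => ?_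
  rw [hQ, ev_rePoly]
  have hn0 : (n : ℂ) + 1 ≠ 0 := by exact_mod_cast Nat.succ_ne_zero n
  simp only [smul_apply, sub_apply,
    ContinuousLinearMap.comp_apply, ContinuousLinearMap.id_apply, smul_eq_mul, map_mul, ev_C,
    map_pow, ev_lin, ContinuousLinearEquiv.coe_coe, conjCLE_apply, conj_I, conj_ofReal, map_neg,
    map_add, map_one, map_natCast, map_sub, map_ofNat]
  field_simp
  ring

/-! ### Equivariance -/

lemma det_eq_one (γ : SL(2, ℤ)) : γ 0 0 * γ 1 1 - γ 0 1 * γ 1 0 = 1 := by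
  have := γ.det_coe
  rwa [Matrix.det_fin_two] at this

lemma coe_smul_eq (γ : SL(2, ℤ)) (τ : ℍ) : ((γ • τ : ℍ) : ℂ) =
    ((γ 0 0 : ℂ) * τ + γ 0 1) / ((γ 1 0 : ℂ) * τ + γ 1 1) := by
  rw [UpperHalfPlane.coe_specialLinearGroup_apply]
  simp

lemma denom_ne_zero (γ : SL(2, ℤ)) {t : ℂ} (ht : t.im ≠ 0) : (γ 1 0 : ℂ) * t + γ 1 1 ≠ 0 := by
  refine linear_ne_zero ht (p := (γ 1 0, γ 1 1)) fun h => ?_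
  have h1 := det_eq_one γ
  rw [Prod.mk_eq_zero] at h
  simp [h.1, h.2] at h1

/-- Right multiplication of a row vector by a matrix. -/
def rowMul (γ : SL(2, ℤ)) (p : ℤ × ℤ) : ℤ × ℤ :=
  (p.1 * γ 0 0 + p.2 * γ 1 0, p.1 * γ 0 1 + p.2 * γ 1 1)

lemma rowMul_inv (γ : SL(2, ℤ)) (p : ℤ × ℤ) : rowMul γ⁻¹ (rowMul γ p) = p := by
  have h := det_eq_one γ
  simp only [rowMul, Matrix.SpecialLinearGroup.SL2_inv_expl]
  ext
  · simp
    linear_combination p.1 * h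
  · simp
    linear_combination p.2 * h

lemma rowMul_mem {N : ℕ} {v : ZMod N × ZMod N} {γ : SL(2, ℤ)}
    (hγ : γ ∈ CongruenceSubgroup.Gamma N) {p : ℤ × ℤ} (hp : p ∈ latticePts N v) :
    rowMul γ p ∈ latticePts N v := by
  obtain ⟨h0, h1, h2⟩ := hp
  rw [CongruenceSubgroup.Gamma_mem] at hγ
  obtain ⟨ha, hb, hc, hd⟩ := hγ
  refine ⟨fun h => h0 ?_, ?_, ?_⟩
  · rw [← rowMul_inv γ p, h]
    simp [rowMul]
  · simp [rowMul, ha, hc, h1]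
  · simp [rowMul, hb, hd, h2]

/-- The bijection of the lattice points in a class modulo `N` given by an element of `Γ(N)`. -/
def rowMulEquiv {N : ℕ} (v : ZMod N × ZMod N) {γ : SL(2, ℤ)}
    (hγ : γ ∈ CongruenceSubgroup.Gamma N) : latticePts N v ≃ latticePts N v where
  toFun p := ⟨rowMul γ p, rowMul_mem hγ p.2⟩
  invFun p := ⟨rowMul γ⁻¹ p, rowMul_mem (inv_mem hγ) p.2⟩
  left_inv p := Subtype.ext (rowMul_inv γ p)
  right_inv p := Subtype.ext (by simpa using rowMul_inv γ⁻¹ p)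

lemma im_smul_eq (γ : SL(2, ℤ)) (τ : ℍ) : ((γ • τ : ℍ).im : ℂ) = τ.im /
    (((γ 1 0 : ℂ) * τ + γ 1 1) * ((γ 1 0 : ℂ) * (starRingEnd ℂ) (τ : ℂ) + γ 1 1)) := by
  have h := ModularGroup.im_smul_eq_div_normSq γ τ
  rw [ModularGroup.denom_apply] at h
  rw [h, Complex.ofReal_div, ← Complex.mul_conj]
  simp

lemma nonholTerm_smul (r s : ℕ) (γ : SL(2, ℤ)) (τ : ℍ) (p : ℤ × ℤ) :
    nonholTerm r s (γ • τ) p = ((γ 1 0 : ℂ) * τ + γ 1 1) ^ r *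
      ((γ 1 0 : ℂ) * (starRingEnd ℂ) (τ : ℂ) + γ 1 1) ^ s * nonholTerm r s τ (rowMul γ p) := by
  have h1 := denom_ne_zero γ τ.im_ne_zero
  have h2 := denom_ne_zero γ (t := (starRingEnd ℂ) (τ : ℂ)) (by simpa using τ.im_ne_zero)
  rw [nonholTerm, nonholTerm, im_smul_eq, coe_smul_eq]
  have e1 : (p.1 : ℂ) * (((γ 0 0 : ℂ) * τ + γ 0 1) / ((γ 1 0 : ℂ) * τ + γ 1 1)) + p.2 =
      (((rowMul γ p).1 : ℂ) * τ + (rowMul γ p).2) / ((γ 1 0 : ℂ) * τ + γ 1 1) := by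
    rw [eq_div_iff h1, add_mul, mul_assoc, div_mul_cancel₀ _ h1]
    simp only [rowMul]
    push_cast
    ring
  have e2 : (p.1 : ℂ) * (starRingEnd ℂ) (((γ 0 0 : ℂ) * τ + γ 0 1) / ((γ 1 0 : ℂ) * τ + γ 1 1))
      + p.2 = (((rowMul γ p).1 : ℂ) * (starRingEnd ℂ) (τ : ℂ) + (rowMul γ p).2) /
        ((γ 1 0 : ℂ) * (starRingEnd ℂ) (τ : ℂ) + γ 1 1) := by
    have := congrArg (starRingEnd ℂ) e1
    simpa using this
  rw [e1, e2]
  generalize (γ 1 0 : ℂ) * τ + γ 1 1 = j at *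
  generalize (γ 1 0 : ℂ) * (starRingEnd ℂ) (τ : ℂ) + γ 1 1 = j' at *
  rw [div_pow, div_pow, div_mul_div_comm, div_div_div_eq, mul_div_assoc',
    div_eq_div_iff_comm]
  have : j ^ (r + 1) * j' ^ (s + 1) = (j * j') * (j ^ r * j' ^ s) := by ring
  rw [this]
  -- The origin is not excluded here; where the denominator vanishes both sides are 0 by the
  -- convention for division by zero.
  by_cases h3 : ((((rowMul γ p).1 : ℂ) * τ + (rowMul γ p).2) ^ (r + 1) *
    (((rowMul γ p).1 : ℂ) * (starRingEnd ℂ) (τ : ℂ) + (rowMul γ p).2) ^ (s + 1)) = 0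
  · simp [h3]
  · field_simp

lemma nonholG_smul {N : ℕ} (r s : ℕ) (v : ZMod N × ZMod N) {γ : SL(2, ℤ)}
    (hγ : γ ∈ CongruenceSubgroup.Gamma N) (τ : ℍ) :
    nonholG N r s v (γ • τ) = ((γ 1 0 : ℂ) * τ + γ 1 1) ^ r *
      ((γ 1 0 : ℂ) * (starRingEnd ℂ) (τ : ℂ) + γ 1 1) ^ s * nonholG N r s v τ := by
  rw [nonholG, nonholG, ← (rowMulEquiv v hγ).tsum_eq (fun p => nonholTerm r s τ p),
    ← tsum_mul_left]
  exact tsum_congr fun p => nonholTerm_smul r s γ τ p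

lemma slash_C (a : ℂ) (γ : SL(2, ℤ)) : slash (MvPolynomial.C a) γ = MvPolynomial.C a := by
  simp [slash, MvPolynomial.algebraMap_eq]

/-- This is det γ = 1. The factor removed from the linear form is the one that `nonholG_smul`
produces, for t = τ as well as for t = τ̄. -/
lemma slash_lin (γ : SL(2, ℤ)) {t : ℂ} (ht : t.im ≠ 0) :
    MvPolynomial.C ((γ 1 0 : ℂ) * t + γ 1 1) *
      slash (lin (((γ 0 0 : ℂ) * t + γ 0 1) / ((γ 1 0 : ℂ) * t + γ 1 1))) γ = lin t := by
  have h1 := denom_ne_zero γ ht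
  have hdet : (γ 0 0 : ℂ) * γ 1 1 - γ 0 1 * γ 1 0 = 1 := by exact_mod_cast det_eq_one γ
  set j := (γ 1 0 : ℂ) * t + γ 1 1 with hj
  have e : slash (lin (((γ 0 0 : ℂ) * t + γ 0 1) / j)) γ =
      (MvPolynomial.C (γ 0 0 : ℂ) * X + MvPolynomial.C (γ 0 1 : ℂ) * Y) -
      MvPolynomial.C (((γ 0 0 : ℂ) * t + γ 0 1) / j) *
        (MvPolynomial.C (γ 1 0 : ℂ) * X + MvPolynomial.C (γ 1 1 : ℂ) * Y) := by
    simp [slash, lin, X, Y, MvPolynomial.algebraMap_eq]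
  rw [e, mul_sub, ← mul_assoc, ← MvPolynomial.C_mul, mul_div_cancel₀ _ h1, lin]
  have hX : j * (γ 0 0 : ℂ) - ((γ 0 0 : ℂ) * t + γ 0 1) * γ 1 0 = 1 := by
    rw [hj]; linear_combination hdet
  have hY : j * (γ 0 1 : ℂ) - ((γ 0 0 : ℂ) * t + γ 0 1) * γ 1 1 = -t := by
    rw [hj]; linear_combination -t * hdet
  have hX' := congrArg (MvPolynomial.C (σ := Fin 2)) hX
  have hY' := congrArg (MvPolynomial.C (σ := Fin 2)) hY
  simp only [map_sub, map_mul, map_neg, map_one] at hX' hY' ⊢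
  linear_combination X * hX' + Y * hY'

lemma slash_mul (P Q : Poly) (γ : SL(2, ℤ)) : slash (P * Q) γ = slash P γ * slash Q γ := by
  simp [slash]

lemma slash_pow (P : Poly) (n : ℕ) (γ : SL(2, ℤ)) : slash (P ^ n) γ = slash P γ ^ n := by
  simp [slash]

lemma nonholPoly_equivariant (N n : ℕ) (v : ZMod N × ZMod N) {γ : SL(2, ℤ)}
    (hγ : γ ∈ CongruenceSubgroup.Gamma N) (τ : ℍ) :
    slash (nonholPoly N n v (γ • τ)) γ = nonholPoly N n v τ := by
  have hsum : ∀ (s : Finset (ℕ × ℕ)) (f : ℕ × ℕ → Poly),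
      slash (∑ i ∈ s, f i) γ = ∑ i ∈ s, slash (f i) γ := fun s f => by simp [slash]
  rw [nonholPoly, slash_mul, slash_C, hsum, nonholPoly]
  congr 1
  refine Finset.sum_congr rfl fun rs _ => ?_
  rw [slash_mul, slash_mul, slash_pow, slash_pow, slash_C, nonholG_smul _ _ v hγ, coe_smul_eq]
  conv_rhs => rw [← slash_lin γ τ.im_ne_zero,
    ← slash_lin γ (t := (starRingEnd ℂ) (τ : ℂ)) (by simpa using τ.im_ne_zero)]
  simp only [map_mul, map_pow, map_div₀, map_add, map_intCast, mul_pow]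
  ring

/-! ### Uniqueness -/

lemma eval_slash (x : Fin 2 → ℂ) (P : Poly) (γ : SL(2, ℤ)) :
    MvPolynomial.eval x (slash P γ) = MvPolynomial.eval
      ![(γ 0 0 : ℂ) * x 0 + γ 0 1 * x 1, (γ 1 0 : ℂ) * x 0 + γ 1 1 * x 1] P := by
  have : (MvPolynomial.eval x).comp ((MvPolynomial.aeval
    ![MvPolynomial.C (γ 0 0 : ℂ) * X + MvPolynomial.C (γ 0 1 : ℂ) * Y,
      MvPolynomial.C (γ 1 0 : ℂ) * X + MvPolynomial.C (γ 1 1 : ℂ) * Y] : Poly →ₐ[ℂ] Poly) :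
      Poly →+* Poly) = MvPolynomial.eval
      ![(γ 0 0 : ℂ) * x 0 + γ 0 1 * x 1, (γ 1 0 : ℂ) * x 0 + γ 1 1 * x 1] := by
    apply MvPolynomial.ringHom_ext
    · intro a
      simp [MvPolynomial.algebraMap_eq]
    · intro i
      fin_cases i <;> simp [X, Y]
  exact congrArg (fun f : Poly →+* ℂ => f P) this

/-- Invariance under the translation by N makes P(z, 1) take one value on all multiples of N, hence
constant, so P = a Y^n. The lower unipotent element then gives a N^n = a · 0^n = 0, because n ≥ 1.
-/
lemma eq_zero_of_slash_eq {N n : ℕ} [NeZero N] (hn : 1 ≤ n) {P : Poly} (hP : P.IsHomogeneous n)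
    (h : ∀ γ ∈ CongruenceSubgroup.Gamma N, slash P γ = P) : P = 0 := by
  let γ₁ : SL(2, ℤ) := ⟨!![1, N; 0, 1], by simp⟩
  let γ₂ : SL(2, ℤ) := ⟨!![1, 0; N, 1], by simp⟩
  have hγ₁ : γ₁ ∈ CongruenceSubgroup.Gamma N := by
    rw [CongruenceSubgroup.Gamma_mem]; simp [γ₁]
  have hγ₂ : γ₂ ∈ CongruenceSubgroup.Gamma N := by
    rw [CongruenceSubgroup.Gamma_mem]; simp [γ₂]
  have hN : (N : ℂ) ≠ 0 := by exact_mod_cast NeZero.ne N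
  have h1 : ∀ x : ℂ, ev (x + N) P = ev x P := by
    intro x
    have := eval_slash ![x, 1] P γ₁
    rw [h _ hγ₁] at this
    simpa [γ₁, ev] using this.symm
  have h2 : MvPolynomial.eval ![1, (N : ℂ)] P = MvPolynomial.eval ![1, 0] P := by
    have := eval_slash ![1, 0] P γ₂
    rw [h _ hγ₂] at this
    simpa [γ₂] using this.symm
  have h3 : ∀ l : ℕ, ev ((l : ℂ) * N) P = ev 0 P := by
    intro l
    induction l with
    | zero => simp
    | succ l ih => rw [← ih, ← h1 ((l : ℂ) * N)]; push_cast; ring_nf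
  have h4 : dehom P = Polynomial.C (ev 0 P) := by
    apply Polynomial.eq_of_infinite_eval_eq
    refine (Set.infinite_range_of_injective (f := fun l : ℕ => (l : ℂ) * N) ?_).mono ?_
    · intro a b hab
      simpa [hN] using hab
    · rintro _ ⟨l, rfl⟩
      simp [eval_dehom, h3]
  have h5 : P = MvPolynomial.C (ev 0 P) * Y ^ n := by
    refine eq_of_ev_eq hP ?_ fun z _ => ?_
    · simpa [Y] using (MvPolynomial.isHomogeneous_C (Fin 2) (ev 0 P)).mul
        ((MvPolynomial.isHomogeneous_X ℂ 1).pow n)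
    · rw [← eval_dehom, h4]
      simp
  rw [h5] at h2
  simp [Y, hN, show n ≠ 0 by omega] at h2
  rw [h5, h2]
  simp

/-- The difference has zero differential on the connected half-plane, so it is a constant polynomial
function of τ; equivariance turns it into an invariant of Γ(N). -/
lemma IsEquivariantPrimitive.unique {N k : ℕ} [NeZero N] (hk : 3 ≤ k) {f : ℍ → ℂ}
    {F G : ℍ → Poly} (hF : IsEquivariantPrimitive N k f F) (hG : IsEquivariantPrimitive N k f G) :
    F = G := by
  have ho : IsOpen {t : ℂ | 0 < t.im} := isOpen_lt continuous_const continuous_im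
  have hpre : IsPreconnected {t : ℂ | 0 < t.im} :=
    (convex_halfSpace_im_gt 0).isPreconnected
  have hconst : ∀ τ τ' : ℍ, F τ - G τ = F τ' - G τ' := by
    intro τ τ'
    ext s
    have hd : ∀ t ∈ {t : ℂ | 0 < t.im}, HasFDerivAt (𝕜 := ℝ)
        (fun z : ℂ => (F (ofComplex z)).coeff s - (G (ofComplex z)).coeff s) 0 t := by
      intro t ht
      have := (hF.hasDeriv ⟨t, ht⟩ s).sub (hG.hasDeriv ⟨t, ht⟩ s)
      rwa [sub_self] at this
    have := ho.is_const_of_fderiv_eq_zero (𝕜 := ℝ) hpre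
      (fun t ht => (hd t ht).differentiableAt.differentiableWithinAt)
      (fun t ht => (hd t ht).fderiv) (x := (τ : ℂ)) (y := (τ' : ℂ)) τ.im_pos τ'.im_pos
    simpa using this
  funext τ
  rw [← sub_eq_zero]
  refine eq_zero_of_slash_eq (N := N) (n := k - 2) (by omega)
    ((hF.homogeneous τ).sub (hG.homogeneous τ)) fun γ hγ => ?_
  conv_rhs => rw [← hF.equivariant γ hγ τ, ← hG.equivariant γ hγ τ]
  rw [hconst τ (γ • τ)]
  simp [slash]

lemma isEquivariantPrimitive_nonholPoly {N n : ℕ} (hn : 1 ≤ n) (v : ZMod N × ZMod N) :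
    IsEquivariantPrimitive N (n + 2) (eisG N (n + 2) v) (nonholPoly N n v) where
  homogeneous := isHomogeneous_nonholPoly N n v
  equivariant := fun _ hγ τ => nonholPoly_equivariant N n v hγ τ
  hasDeriv := hasDeriv_nonholPoly hn v

/-! ### Sums over arithmetic progressions -/

lemma norm_cexp_two_pi_mul (w : ℂ) : ‖cexp (2 * Real.pi * I * w)‖ =
    Real.exp (-(2 * Real.pi * w.im)) := by
  rw [Complex.norm_exp]
  congr 1
  simp

lemma exp_neg_two_pi_lt_one : Real.exp (-(2 * Real.pi)) < 1 := by
  rw [Real.exp_lt_one_iff]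
  linarith [Real.pi_pos]

/-- Lipschitz's formula writes the sum as a power series in q = e^(2πiw) without constant term, so
it is O(|q|) once |q| ≤ e^(-2π). -/
lemma exists_bound_tsum_inv_pow_upper {j : ℕ} (hj : 2 ≤ j) : ∃ C : ℝ, ∀ w : ℂ, 1 ≤ w.im →
    ‖∑' l : ℤ, 1 / (w + l) ^ j‖ ≤ C * Real.exp (-(2 * Real.pi * w.im)) := by
  obtain ⟨k, rfl⟩ : ∃ k, j = k + 1 := ⟨j - 1, by omega⟩
  set ρ := Real.exp (-(2 * Real.pi)) with hρ
  have hρ0 : 0 < ρ := Real.exp_pos _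
  have hs : Summable fun n : ℕ => (n : ℝ) ^ k * ρ ^ n :=
    summable_pow_mul_geometric_of_norm_lt_one k (by
      rw [Real.norm_of_nonneg hρ0.le]; exact exp_neg_two_pi_lt_one)
  refine ⟨‖(-2 * Real.pi * I) ^ (k + 1) / (k.factorial : ℂ)‖ *
    ((∑' n : ℕ, (n : ℝ) ^ k * ρ ^ n) / ρ), fun w hw => ?_⟩
  have hq := norm_cexp_two_pi_mul w
  set q := cexp (2 * Real.pi * I * w) with hqdef
  have hqρ : ‖q‖ ≤ ρ := by
    rw [hq, hρ]
    apply Real.exp_le_exp.mpr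
    nlinarith [Real.pi_pos]
  have h := EisensteinSeries.qExpansion_identity (k := k) (by omega) ⟨w, by linarith⟩
  simp only at h
  rw [h, norm_mul, ← hq]
  refine le_of_le_of_eq (mul_le_mul_of_nonneg_left ?_ (norm_nonneg _)) (mul_assoc _ _ _).symm
  -- One factor |q| is kept and the others are bounded by ρ, whence the division by ρ; the term n =
  -- 0 vanishes as k ≥ 1.
  have hb : ∀ n : ℕ, ‖(n : ℂ) ^ k * q ^ n‖ ≤ (n : ℝ) ^ k * ρ ^ n * (‖q‖ / ρ) := by
    intro n
    rw [norm_mul, norm_pow, norm_pow, Complex.norm_natCast]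
    rcases n with _ | n
    · simp [show k ≠ 0 by omega]
    · rw [mul_assoc]
      gcongr
      rw [pow_succ, pow_succ, mul_assoc, mul_div_cancel₀ _ hρ0.ne']
      gcongr
  calc _ ≤ ∑' n : ℕ, (n : ℝ) ^ k * ρ ^ n * (‖q‖ / ρ) :=
        tsum_of_norm_bounded (hs.mul_right _).hasSum hb
    _ = _ := by rw [tsum_mul_right]; ring

lemma tsum_inv_pow_neg (w : ℂ) (j : ℕ) :
    ∑' l : ℤ, 1 / (-w + l) ^ j = (-1) ^ j * ∑' l : ℤ, 1 / (w + l) ^ j := by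
  rw [← (Equiv.neg ℤ).tsum_eq, ← tsum_mul_left]
  refine tsum_congr fun l => ?_
  have : -w + ((Equiv.neg ℤ l : ℤ) : ℂ) = (-1) * (w + l) := by
    simp
    ring
  rw [this, mul_pow, one_div, mul_inv, ← inv_pow, one_div]
  norm_num

/-- A sum of inverse powers over an arithmetic progression decays exponentially. -/
lemma exists_bound_tsum_inv_pow (N : ℕ) [NeZero N] {j : ℕ} (hj : 2 ≤ j) : ∃ C : ℝ, 0 ≤ C ∧
    ∀ w : ℂ, N ≤ |w.im| →
    ‖∑' l : ℤ, 1 / (w + N * l) ^ j‖ ≤ C * Real.exp (-(2 * Real.pi / N * |w.im|)) := by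
  obtain ⟨C, hC⟩ := exists_bound_tsum_inv_pow_upper hj
  have hN : (N : ℂ) ≠ 0 := by exact_mod_cast NeZero.ne N
  have hN0 : (0 : ℝ) < N := by exact_mod_cast Nat.pos_of_ne_zero (NeZero.ne N)
  have key : ∀ w : ℂ, 1 ≤ |w.im| →
      ‖∑' l : ℤ, 1 / (w + l) ^ j‖ ≤ |C| * Real.exp (-(2 * Real.pi * |w.im|)) := by
    intro w hw
    rcases le_total 0 w.im with h | h
    · rw [abs_of_nonneg h] at hw ⊢
      exact (hC w hw).trans (by gcongr; exact le_abs_self C)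
    · have := tsum_inv_pow_neg (-w) j
      rw [neg_neg] at this
      rw [abs_of_nonpos h] at hw ⊢
      rw [this, norm_mul, norm_pow, norm_neg, norm_one, one_pow, one_mul]
      refine (hC (-w) (by simpa using hw)).trans ?_
      rw [neg_im]
      gcongr
      exact le_abs_self C
  refine ⟨‖1 / (N : ℂ) ^ j‖ * |C|, by positivity, fun w hw => ?_⟩
  have e : ∑' l : ℤ, 1 / (w + N * l) ^ j = 1 / (N : ℂ) ^ j * ∑' l : ℤ, 1 / (w / N + l) ^ j := by
    rw [← tsum_mul_left]
    refine tsum_congr fun l => ?_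
    rw [one_div_mul_one_div, ← mul_pow, mul_add, mul_div_cancel₀ _ hN]
  have him : (w / N).im = w.im / N := by
    rw [show w / N = w / ((N : ℝ) : ℂ) by simp, Complex.div_ofReal_im]
  have habs : |(w / N).im| = |w.im| / N := by rw [him, abs_div, abs_of_pos hN0]
  rw [e, norm_mul, mul_assoc]
  gcongr
  refine (key (w / N) (by rw [habs, le_div_iff₀ hN0]; linarith)).trans_eq ?_
  rw [habs]
  congr 2
  ring

lemma exists_bound_cot : ∃ C : ℝ, 0 ≤ C ∧ ∀ w : ℂ, 1 ≤ |w.im| →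
    ‖Real.pi * cot (Real.pi * w) - -(Real.pi * I * (SignType.sign w.im : ℝ))‖ ≤
      C * Real.exp (-(2 * Real.pi * |w.im|)) := by
  set ρ := Real.exp (-(2 * Real.pi)) with hρ
  have hρ1 : ρ < 1 := exp_neg_two_pi_lt_one
  have key : ∀ w : ℂ, 1 ≤ w.im → ‖Real.pi * cot (Real.pi * w) + Real.pi * I‖ ≤
      2 * Real.pi / (1 - ρ) * Real.exp (-(2 * Real.pi * w.im)) := by
    intro w hw
    have hq := norm_cexp_two_pi_mul w
    have h := pi_mul_cot_pi_q_exp ⟨w, by linarith⟩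
    simp only at h
    set q := cexp (2 * Real.pi * I * w) with hqdef
    have hqρ : ‖q‖ ≤ ρ := by
      rw [hq, hρ]
      apply Real.exp_le_exp.mpr
      nlinarith [Real.pi_pos]
    have hq1 : ‖q‖ < 1 := hqρ.trans_lt hρ1
    have hne : 1 - q ≠ 0 := by
      intro h0
      rw [sub_eq_zero] at h0
      rw [← h0] at hq1
      simp at hq1
    have e : (Real.pi : ℂ) * cot (Real.pi * w) + Real.pi * I =
        -(2 * Real.pi * I) * q / (1 - q) := by
      rw [h, tsum_geometric_of_norm_lt_one hq1]
      field_simp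
      ring
    have hden : 1 - ρ ≤ ‖1 - q‖ := by
      have := norm_sub_norm_le (1 : ℂ) q
      rw [norm_one] at this
      linarith
    rw [e, ← hq, norm_div, norm_mul, norm_neg]
    have : ‖2 * (Real.pi : ℂ) * I‖ = 2 * Real.pi := by
      simp [abs_of_pos Real.pi_pos]
    rw [this, div_mul_eq_mul_div]
    have := Real.pi_pos
    gcongr
  refine ⟨2 * Real.pi / (1 - ρ), ?_, fun w hw => ?_⟩
  · have := Real.pi_pos
    have : 0 < 1 - ρ := by linarith
    positivity
  rcases lt_trichotomy w.im 0 with h | h | h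
  · rw [sign_neg h]
    rw [abs_of_neg h] at hw ⊢
    have := key (-w) (by simpa using hw)
    rw [neg_im, mul_neg, Complex.cot, Complex.cos_neg, Complex.sin_neg, div_neg,
      ← norm_neg] at this
    refine (congrArg norm ?_).trans_le this
    simp [Complex.cot]
    ring
  · rw [h] at hw
    norm_num at hw
  · rw [sign_pos h]
    rw [abs_of_pos h] at hw ⊢
    have := key w hw
    refine (congrArg norm ?_).trans_le this
    simp

lemma summable_inv_linear_sq {w : ℂ} : Summable fun l : ℤ => ‖1 / (w + l) ^ 2‖ := by
  have := (EisensteinSeries.linear_right_summable w 1 (k := 2) le_rfl).norm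
  refine this.congr fun l => ?_
  norm_num [zpow_ofNat]

lemma summable_inv_sub_inv {a b : ℂ} (ha : a.im ≠ 0) (hb : b.im ≠ 0) :
    Summable fun l : ℤ => 1 / (a + l) - 1 / (b + l) := by
  have hs := ((summable_inv_linear_sq (w := a)).add (summable_inv_linear_sq (w := b))).mul_left
    ‖b - a‖
  refine Summable.of_norm_bounded hs fun l => ?_
  have h1 : a + l ≠ 0 := by
    intro h; apply ha; simpa using congrArg Complex.im h
  have h2 : b + l ≠ 0 := by
    intro h; apply hb; simpa using congrArg Complex.im h
  have e : 1 / (a + l) - 1 / (b + l) = (b - a) * ((1 / (a + l)) * (1 / (b + l))) := by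
    field_simp
    ring
  rw [e, norm_mul]
  refine mul_le_mul_of_nonneg_left ?_ (norm_nonneg _)
  rw [norm_mul, ← one_div_pow, ← one_div_pow, norm_pow, norm_pow]
  nlinarith [sq_nonneg (‖1 / (a + l)‖ - ‖1 / (b + l)‖), sq_nonneg ‖1 / (a + l)‖,
    sq_nonneg ‖1 / (b + l)‖]

lemma mem_integerComplement {a : ℂ} (ha : a.im ≠ 0) : a ∈ Complex.integerComplement := by
  rintro ⟨n, rfl⟩
  simp at ha

/-- Difference of two Mittag-Leffler expansions of the cotangent. Those expansions pair l with -l,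
whereas the difference converges absolutely and may be split into its positive, negative and zero
parts. -/
lemma tsum_inv_sub_inv {a b : ℂ} (ha : a.im ≠ 0) (hb : b.im ≠ 0) :
    ∑' l : ℤ, (1 / (a + l) - 1 / (b + l)) =
      Real.pi * cot (Real.pi * a) - Real.pi * cot (Real.pi * b) := by
  have hs := summable_inv_sub_inv ha hb
  have h1 : Summable fun n : ℕ => 1 / (a + (n + 1)) - 1 / (b + (n + 1)) := by
    refine (hs.comp_injective (i := fun n : ℕ => (n : ℤ) + 1)
      (fun a b h => by simpa using h)).congr fun n => ?_
    simp
  have h2 : Summable fun n : ℕ => 1 / (a - (n + 1)) - 1 / (b - (n + 1)) := by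
    refine (hs.comp_injective (i := fun n : ℕ => -((n : ℤ) + 1))
      (fun a b h => by simpa using h)).congr fun n => ?_
    simp only [Function.comp_apply]
    push_cast
    ring
  have sa := (summable_cotTerm (mem_integerComplement ha)).hasSum
  have sb := (summable_cotTerm (mem_integerComplement hb)).hasSum
  have ea : ∑' n, cotTerm a n = Real.pi * cot (Real.pi * a) - 1 / a :=
    (cot_series_rep' (mem_integerComplement ha)).symm
  have eb : ∑' n, cotTerm b n = Real.pi * cot (Real.pi * b) - 1 / b :=
    (cot_series_rep' (mem_integerComplement hb)).symm
  have hsplit := HasSum.of_add_one_of_neg_add_one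
    (f := fun l : ℤ => 1 / (a + l) - 1 / (b + l))
    (m := ∑' n : ℕ, (1 / (a + (n + 1)) - 1 / (b + (n + 1))))
    (m' := ∑' n : ℕ, (1 / (a - (n + 1)) - 1 / (b - (n + 1))))
    (h1.hasSum.congr_fun fun n => by push_cast; rfl)
    (h2.hasSum.congr_fun fun n => by push_cast; ring)
  have hadd := (h1.hasSum.add h2.hasSum).unique ((sa.sub sb).congr_fun fun n => by
    simp only [cotTerm]
    ring)
  rw [hsplit.tsum_eq]
  simp only [Int.cast_zero, add_zero]
  rw [ea, eb] at hadd
  linear_combination hadd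

/-! ### Behaviour at the cusp -/

lemma tsum_residue {N : ℕ} [NeZero N] (d : ZMod N) (h : ℤ → ℂ) :
    ∑' l : ℤ, (if (l : ZMod N) = d then h l else 0) = ∑' l : ℤ, h (d.val + N * l) := by
  have hN : (N : ℤ) ≠ 0 := by exact_mod_cast NeZero.ne N
  have hinj : Function.Injective fun l : ℤ => (d.val : ℤ) + N * l := fun a b hab =>
    mul_left_cancel₀ hN (add_left_cancel hab)
  have hsupp : Function.support (fun l : ℤ => if (l : ZMod N) = d then h l else 0) ⊆
      Set.range fun l : ℤ => (d.val : ℤ) + N * l := by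
    intro l hl
    rw [Function.mem_support] at hl
    have hd : (l : ZMod N) = d := by
      by_contra hne
      simp [hne] at hl
    have : ((l - d.val : ℤ) : ZMod N) = 0 := by
      push_cast
      rw [hd, ZMod.natCast_zmod_val, sub_self]
    rw [ZMod.intCast_zmod_eq_zero_iff_dvd] at this
    obtain ⟨c, hc⟩ := this
    exact ⟨c, by simp only; omega⟩
  rw [← hinj.tsum_eq hsupp]
  refine tsum_congr fun l => ?_
  rw [if_pos]
  push_cast
  simp

/-- Summation by rows, with the row m = 0 kept apart because it gives the part of the Eisenstein
series that survives at the cusp. The omitted origin is harmless since f vanishes there. -/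
lemma tsum_latticePts {N : ℕ} [NeZero N] (v : ZMod N × ZMod N) {f : ℤ × ℤ → ℂ}
    (hf : Summable f) (hf0 : f 0 = 0) :
    Summable (fun m : ℤ => if m ≠ 0 ∧ (m : ZMod N) = v.1 then
      ∑' l : ℤ, f (m, v.2.val + N * l) else 0) ∧
    ∑' p : latticePts N v, f p =
      (if v.1 = 0 then ∑' l : ℤ, (if (l : ZMod N) = v.2 then f (0, l) else 0) else 0) +
      ∑' m : ℤ, if m ≠ 0 ∧ (m : ZMod N) = v.1 then
        ∑' l : ℤ, f (m, v.2.val + N * l) else 0 := by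
  classical
  have hg : Summable ((latticePts N v).indicator f) := hf.indicator _
  have hgap : ∀ m l : ℤ, (latticePts N v).indicator f (m, l) =
      if (m : ZMod N) = v.1 then (if (l : ZMod N) = v.2 then f (m, l) else 0) else 0 := by
    intro m l
    rw [Set.indicator_apply]
    by_cases h0 : ((m, l) : ℤ × ℤ) = 0
    · simp [h0, hf0]
    · simp only [latticePts, Set.mem_ofPred_eq, ne_eq, h0, not_false_eq_true, true_and, ite_and]
  have hin : ∀ m : ℤ, ∑' l : ℤ, (latticePts N v).indicator f (m, l) =
      if (m : ZMod N) = v.1 then ∑' l : ℤ, f (m, v.2.val + N * l) else 0 := by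
    intro m
    simp only [hgap]
    split_ifs with h
    · exact tsum_residue v.2 fun l => f (m, l)
    · simp
  have hsum := hg.prod
  have heq : (fun m : ℤ => if m = 0 then 0 else ∑' l : ℤ, (latticePts N v).indicator f (m, l)) =
      fun m : ℤ => if m ≠ 0 ∧ (m : ZMod N) = v.1 then
        ∑' l : ℤ, f (m, v.2.val + N * l) else 0 := by
    funext m
    rw [hin]
    by_cases h : m = 0 <;> simp [h]
  constructor
  · rw [← heq]
    refine (hsum.indicator {m : ℤ | m ≠ 0}).congr fun m => ?_
    by_cases h : m = 0 <;> simp [h]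
  · rw [tsum_subtype (latticePts N v) f, hg.tsum_prod, hsum.tsum_eq_add_tsum_ite 0, ← heq]
    congr 1
    simp only [hgap, Int.cast_zero, eq_comm (a := (0 : ZMod N))]
    split_ifs <;> simp

lemma add_mul_ne_zero (N : ℕ) {a : ℂ} (ha : a.im ≠ 0) (l : ℤ) : a + N * l ≠ 0 := by
  intro h
  apply ha
  have := congrArg Complex.im h
  simpa using this

lemma im_div_nat (N : ℕ) (w : ℂ) : (w / N).im = w.im / N := by
  rw [show w / N = w / ((N : ℝ) : ℂ) by simp, Complex.div_ofReal_im]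

lemma im_div_nat_ne_zero (N : ℕ) [NeZero N] {a : ℂ} (ha : a.im ≠ 0) : (a / N).im ≠ 0 := by
  rw [im_div_nat]
  exact div_ne_zero ha (by exact_mod_cast NeZero.ne N)

lemma inv_add_mul_sub (N : ℕ) [NeZero N] (a b : ℂ) (l : ℤ) :
    1 / (a + N * l) - 1 / (b + N * l) = 1 / N * (1 / (a / N + l) - 1 / (b / N + l)) := by
  have hN : (N : ℂ) ≠ 0 := by exact_mod_cast NeZero.ne N
  rw [mul_sub, one_div_mul_one_div, one_div_mul_one_div, mul_add, mul_add, mul_div_cancel₀ _ hN,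
    mul_div_cancel₀ _ hN]

lemma summable_inv_add_mul_pow (N : ℕ) [NeZero N] (a : ℂ) {j : ℕ} (hj : 2 ≤ j) :
    Summable fun l : ℤ => 1 / (a + N * l) ^ j := by
  have hN : (N : ℂ) ≠ 0 := by exact_mod_cast NeZero.ne N
  have := EisensteinSeries.linear_right_summable (a / N) 1 (k := j) (by exact_mod_cast hj)
  refine (this.mul_left (1 / (N : ℂ) ^ j)).congr fun l => ?_
  rw [zpow_natCast, ← one_div, one_div_mul_one_div, ← mul_pow, mul_add, Int.cast_one, one_mul,
    mul_div_cancel₀ _ hN]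

lemma div_mul_eq_inv_sub {x y δ : ℂ} {m : ℤ} (hx : x ≠ 0) (hy : y ≠ 0) (hm : m ≠ 0)
    (h : y - x = m * δ) : δ / (x * y) = 1 / m * (1 / x - 1 / y) := by
  have hm' : (m : ℂ) ≠ 0 := by exact_mod_cast hm
  field_simp
  linear_combination -h

/-- Used with x = mt + l, y = mz + l and δ = z - t: each step lowers the order of the pole in x, at
the price of a factor -1/m and of a pure power of x. -/
lemma partialFraction_succ {x y δ : ℂ} {m : ℤ} (hx : x ≠ 0) (hy : y ≠ 0) (hm : m ≠ 0)
    (h : y - x = m * δ) (j : ℕ) : (δ / x) ^ (j + 2) / y =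
      1 / m * (δ ^ (j + 1) * (1 / x ^ (j + 2)) - (δ / x) ^ (j + 1) / y) := by
  have e : (δ / x) ^ (j + 2) / y = (δ / x) ^ (j + 1) * (δ / (x * y)) := by
    rw [pow_succ _ (j + 1)]
    field_simp
  rw [e, div_mul_eq_inv_sub hx hy hm h, div_pow, pow_succ x (j + 1)]
  field_simp

/-! ### One row of the lattice sum by partial fractions -/

section PartialFractions

variable {N : ℕ} [NeZero N] {a b δ : ℂ} {m : ℤ}

lemma summable_partialFraction (ha : a.im ≠ 0) (hb : b.im ≠ 0) (hm : m ≠ 0)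
    (hab : b - a = m * δ) (j : ℕ) :
    Summable fun l : ℤ => (δ / (a + N * l)) ^ (j + 1) / (b + N * l) := by
  have hab' : ∀ l : ℤ, (b + N * l) - (a + N * l) = m * δ := fun l => by rw [← hab]; ring
  induction j with
  | zero =>
    refine ((summable_inv_sub_inv (im_div_nat_ne_zero N ha)
      (im_div_nat_ne_zero N hb)).mul_left (1 / (m : ℂ) * (1 / N))).congr fun l => ?_
    rw [mul_assoc, ← inv_add_mul_sub, ← div_mul_eq_inv_sub (add_mul_ne_zero N ha l)
      (add_mul_ne_zero N hb l) hm (hab' l), zero_add, pow_one, div_div]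
  | succ j ih =>
    refine ((((summable_inv_add_mul_pow N a (j := j + 2) (by omega)).mul_left
      (δ ^ (j + 1))).sub ih).mul_left (1 / (m : ℂ))).congr fun l => ?_
    exact (partialFraction_succ (add_mul_ne_zero N ha l) (add_mul_ne_zero N hb l) hm (hab' l) j).symm

lemma tsum_partialFraction_zero (ha : a.im ≠ 0) (hb : b.im ≠ 0) (hm : m ≠ 0)
    (hab : b - a = m * δ) :
    ∑' l : ℤ, (δ / (a + N * l)) ^ (0 + 1) / (b + N * l) = 1 / m * (1 / N *
      (Real.pi * cot (Real.pi * (a / N)) - Real.pi * cot (Real.pi * (b / N)))) := by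
  rw [← tsum_inv_sub_inv (im_div_nat_ne_zero N ha) (im_div_nat_ne_zero N hb), ← tsum_mul_left,
    ← tsum_mul_left]
  refine tsum_congr fun l => ?_
  rw [← inv_add_mul_sub, ← div_mul_eq_inv_sub (add_mul_ne_zero N ha l)
      (add_mul_ne_zero N hb l) hm (by rw [← hab]; ring), zero_add, pow_one, div_div]

lemma tsum_partialFraction_succ (ha : a.im ≠ 0) (hb : b.im ≠ 0) (hm : m ≠ 0)
    (hab : b - a = m * δ) (j : ℕ) :
    ∑' l : ℤ, (δ / (a + N * l)) ^ (j + 2) / (b + N * l) = 1 / m *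
      (δ ^ (j + 1) * ∑' l : ℤ, 1 / (a + N * l) ^ (j + 2) -
        ∑' l : ℤ, (δ / (a + N * l)) ^ (j + 1) / (b + N * l)) := by
  rw [← tsum_mul_left, ← Summable.tsum_sub
    ((summable_inv_add_mul_pow N a (j := j + 2) (by omega)).mul_left _)
    (summable_partialFraction ha hb hm hab j), ← tsum_mul_left]
  exact tsum_congr fun l => partialFraction_succ (add_mul_ne_zero N ha l) (add_mul_ne_zero N hb l)
    hm (by rw [← hab]; ring) j

end PartialFractions

lemma norm_one_div_int_le {m : ℤ} (hm : m ≠ 0) : ‖1 / (m : ℂ)‖ ≤ 1 := by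
  rw [norm_div, norm_one, Complex.norm_intCast, div_le_one (by positivity)]
  exact_mod_cast Int.one_le_abs hm

/-- Induction on the order of the pole. The base case is a difference of cotangents, of which the
one at a/N is close to ∓i; every further step multiplies by -1/m and adds a power sum that decays
exponentially. The constant must not depend on m, a, b or δ, so that the rows can be summed. -/
lemma exists_bound_partialFraction (N : ℕ) [NeZero N] (j : ℕ) : ∃ C : ℝ, 0 ≤ C ∧
    ∀ (a b δ : ℂ) (m : ℤ), N ≤ |a.im| → b.im ≠ 0 → m ≠ 0 → b - a = m * δ →
    ‖∑' l : ℤ, (δ / (a + N * l)) ^ (j + 1) / (b + N * l) - (-1) ^ j * (1 / m) ^ (j + 1) * (1 / N *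
      (-(Real.pi * I * (SignType.sign a.im : ℝ)) - Real.pi * cot (Real.pi * (b / N))))‖ ≤
    C * (1 + ‖δ‖) ^ j * Real.exp (-(2 * Real.pi / N * |a.im|)) := by
  have hN0 : (0 : ℝ) < N := by exact_mod_cast Nat.pos_of_ne_zero (NeZero.ne N)
  have hne : ∀ a : ℂ, (N : ℝ) ≤ |a.im| → a.im ≠ 0 := fun a ha h => by
    rw [h, abs_zero] at ha
    linarith
  induction j with
  | zero =>
    obtain ⟨C, hC0, hC⟩ := exists_bound_cot
    refine ⟨‖1 / (N : ℂ)‖ * C, by positivity, fun a b δ m ha hb hm hab => ?_⟩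
    rw [tsum_partialFraction_zero (hne a ha) hb hm hab, pow_zero, zero_add, pow_one, one_mul,
      ← mul_sub, ← mul_sub, sub_sub_sub_cancel_right, norm_mul, norm_mul, pow_zero, mul_one,
      mul_assoc ‖1 / (N : ℂ)‖]
    have habs : |(a / N).im| = |a.im| / N := by rw [im_div_nat, abs_div, abs_of_pos hN0]
    have h1 := hC (a / N) (by rw [habs, le_div_iff₀ hN0]; linarith)
    have hsgn : SignType.sign (a / N).im = SignType.sign a.im := by
      rw [im_div_nat, div_eq_mul_inv, sign_mul, sign_pos (inv_pos.mpr hN0), mul_one]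
    rw [habs, hsgn] at h1
    rw [show 2 * Real.pi / N * |a.im| = 2 * Real.pi * (|a.im| / N) by ring]
    calc _ ≤ 1 * (‖1 / (N : ℂ)‖ * (C * Real.exp (-(2 * Real.pi * (|a.im| / N))))) := by
          refine mul_le_mul (norm_one_div_int_le hm) (mul_le_mul_of_nonneg_left h1 (norm_nonneg _))
            (by positivity) zero_le_one
      _ = _ := one_mul _
  | succ j ih =>
    obtain ⟨C, hC0, hC⟩ := ih
    obtain ⟨C', hC'0, hC'⟩ := exists_bound_tsum_inv_pow N (j := j + 2) (by omega)
    refine ⟨C' + C, by positivity, fun a b δ m ha hb hm hab => ?_⟩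
    rw [tsum_partialFraction_succ (hne a ha) hb hm hab]
    have h1 := hC a b δ m ha hb hm hab
    have h2 := hC' a ha
    set L := ∑' l : ℤ, 1 / (a + N * l) ^ (j + 2)
    set U := ∑' l : ℤ, (δ / (a + N * l)) ^ (j + 1) / (b + N * l)
    set D := (1 / (N : ℂ) *
      (-(Real.pi * I * (SignType.sign a.im : ℝ)) - Real.pi * cot (Real.pi * (b / N))))
    set E := Real.exp (-(2 * Real.pi / N * |a.im|))
    have e : 1 / (m : ℂ) * (δ ^ (j + 1) * L - U) - (-1) ^ (j + 1) * (1 / m) ^ (j + 1 + 1) * D =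
        1 / (m : ℂ) * (δ ^ (j + 1) * L - (U - (-1) ^ j * (1 / m) ^ (j + 1) * D)) := by ring
    rw [e, norm_mul]
    have h3 : ‖δ‖ ^ (j + 1) ≤ (1 + ‖δ‖) ^ (j + 1) := by
      gcongr
      linarith
    have h4 : (1 + ‖δ‖) ^ j ≤ (1 + ‖δ‖) ^ (j + 1) := by
      apply pow_le_pow_right₀ _ (Nat.le_succ j)
      linarith [norm_nonneg δ]
    have hE : 0 < E := Real.exp_pos _
    calc _ ≤ 1 * (‖δ‖ ^ (j + 1) * (C' * E) + C * (1 + ‖δ‖) ^ j * E) := by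
          refine mul_le_mul (norm_one_div_int_le hm) ((norm_sub_le _ _).trans ?_) (norm_nonneg _)
            zero_le_one
          rw [norm_mul, norm_pow]
          gcongr
      _ ≤ 1 * ((1 + ‖δ‖) ^ (j + 1) * (C' * E) + C * (1 + ‖δ‖) ^ (j + 1) * E) := by gcongr
      _ = _ := by ring

/-- The contribution of `m = 0` to the Eisenstein series of weight `k`. -/
noncomputable def cuspValue (N k : ℕ) (v : ZMod N × ZMod N) : ℂ :=
  if v.1 = 0 then ∑' l : ℤ, (if (l : ZMod N) = v.2 then 1 / (l : ℂ) ^ k else 0) else 0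

/-- The reality of a_0 is what removes the term a_0 z^(n+1) when the real part is taken. -/
lemma conj_cuspValue (N k : ℕ) (v : ZMod N × ZMod N) :
    (starRingEnd ℂ) (cuspValue N k v) = cuspValue N k v := by
  rw [cuspValue]
  split_ifs
  · rw [Complex.conj_tsum]
    refine tsum_congr fun l => ?_
    split_ifs <;> simp
  · simp

/-- The `m`-th term of the constant term at the cusp of `psi`. -/
noncomputable def psiLimitTerm (N n : ℕ) (v : ZMod N × ZMod N) (z : ℂ) (m : ℤ) : ℂ :=
  if m ≠ 0 ∧ (m : ZMod N) = v.1 then (-1) ^ n * (1 / m) ^ (n + 1) * (1 / N *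
    (-(Real.pi * I * (SignType.sign m : ℝ)) -
      Real.pi * cot (Real.pi * ((m * z + v.2.val) / N)))) else 0

/-- The constant term at the cusp of `psi`. -/
noncomputable def psiLimit (N n : ℕ) (v : ZMod N × ZMod N) (z : ℂ) : ℂ :=
  ∑' m : ℤ, psiLimitTerm N n v z m

lemma summable_exp_neg_pi_mul_abs : Summable fun m : ℤ => Real.exp (-(Real.pi * |(m : ℝ)|)) := by
  have h : Summable fun m : ℕ => Real.exp (-Real.pi) ^ m :=
    summable_geometric_of_lt_one (Real.exp_pos _).le
      (by rw [Real.exp_lt_one_iff]; linarith [Real.pi_pos])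
  rw [summable_int_iff_summable_nat_and_neg]
  constructor <;>
  · refine h.congr fun m => ?_
    rw [← Real.exp_nat_mul]
    congr 1
    simp
    ring

/-- From 2xy ≥ x + y for x, y ≥ 1. One factor gives the decay at the cusp, the other the convergence
over m. -/
lemma exp_le_exp_mul_exp {N : ℕ} [NeZero N] {y : ℝ} (hy : N ≤ y) {m : ℤ} (hm : m ≠ 0) :
    Real.exp (-(2 * Real.pi / N * (|(m : ℝ)| * y))) ≤
      Real.exp (-(Real.pi / N * y)) * Real.exp (-(Real.pi * |(m : ℝ)|)) := by
  have hN0 : (0 : ℝ) < N := by exact_mod_cast Nat.pos_of_ne_zero (NeZero.ne N)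
  rw [← Real.exp_add]
  apply Real.exp_le_exp.mpr
  have h1 : (1 : ℝ) ≤ |(m : ℝ)| := by exact_mod_cast Int.one_le_abs hm
  have h2 : 1 ≤ y / N := by rwa [le_div_iff₀ hN0, one_mul]
  have e1 : 2 * Real.pi / N * (|(m : ℝ)| * y) = Real.pi * (2 * |(m : ℝ)| * (y / N)) := by ring
  have e2 : Real.pi / N * y = Real.pi * (y / N) := by ring
  rw [e1, e2, ← neg_add, ← mul_add, neg_le_neg_iff]
  apply mul_le_mul_of_nonneg_left _ Real.pi_pos.le
  nlinarith

lemma im_int_mul_add_nat (m : ℤ) (t : ℂ) (d : ℕ) : ((m : ℂ) * t + d).im = m * t.im := by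
  simp

/-- The behaviour of `psi` at the cusp. -/
lemma exists_bound_psi {N n : ℕ} [NeZero N] (hn : 1 ≤ n) (v : ZMod N × ZMod N) {z : ℂ}
    (hz : z.im ≠ 0) : Summable (psiLimitTerm N n v z) ∧ ∃ C : ℝ, ∀ t : ℂ, N ≤ t.im →
    ‖psi N n v z t - cuspValue N (n + 2) v * (z - t) ^ (n + 1) - psiLimit N n v z‖ ≤
      C * ((1 + ‖z - t‖) ^ n * Real.exp (-(Real.pi / N * t.im))) := by
  obtain ⟨C, hC0, hC⟩ := exists_bound_partialFraction N n
  have hN0 : (0 : ℝ) < N := by exact_mod_cast Nat.pos_of_ne_zero (NeZero.ne N)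
  -- The summability of the limit terms does not involve t, yet it is derived from that of the rows
  -- at some t; t = N i will do.
  suffices key : ∀ t : ℂ, N ≤ t.im → Summable (psiLimitTerm N n v z) ∧
      ‖psi N n v z t - cuspValue N (n + 2) v * (z - t) ^ (n + 1) - psiLimit N n v z‖ ≤
      C * (∑' m : ℤ, Real.exp (-(Real.pi * |(m : ℝ)|))) *
        ((1 + ‖z - t‖) ^ n * Real.exp (-(Real.pi / N * t.im))) from
    ⟨(key (N * I) (by simp)).1, _, fun t ht => (key t ht).2⟩
  intro t ht
  have ht0 : 0 < t.im := hN0.trans_le ht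
  have hsum : Summable (fun p : ℤ × ℤ => psiTerm n z t p) := by
    obtain ⟨r, hr, H⟩ := exists_lower_bound ht0.ne'
    obtain ⟨s, hs, H'⟩ := exists_lower_bound hz
    refine Summable.of_norm_bounded ((summable_inv_norm_pow (k := n + 2) (by omega)).mul_left
      ((‖z - t‖ / r) ^ (n + 1) / s)) fun p => ?_
    rcases eq_or_ne p 0 with rfl | hp
    · simp [psiTerm]
    · exact norm_psiTerm_le n hr hs hp (H p) (H' p) le_rfl
  obtain ⟨hs1, hs2⟩ := tsum_latticePts v hsum (by simp [psiTerm])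
  have h0 : (if v.1 = 0 then
      ∑' l : ℤ, (if (l : ZMod N) = v.2 then psiTerm n z t (0, l) else 0) else 0) =
      cuspValue N (n + 2) v * (z - t) ^ (n + 1) := by
    rw [cuspValue, ite_mul, zero_mul, ← tsum_mul_right]
    refine if_congr Iff.rfl (tsum_congr fun l => ?_) rfl
    rw [ite_mul, zero_mul]
    refine if_congr Iff.rfl ?_ rfl
    simp only [psiTerm, Int.cast_zero, zero_mul, zero_add, div_pow]
    rw [div_div, ← pow_succ, one_div_mul_eq_div]
  set inner : ℤ → ℂ := fun m => if m ≠ 0 ∧ (m : ZMod N) = v.1 then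
        ∑' l : ℤ, psiTerm n z t (m, v.2.val + N * l) else 0 with hinner
  have hb : ∀ m : ℤ, ‖inner m - psiLimitTerm N n v z m‖ ≤
      C * (1 + ‖z - t‖) ^ n * Real.exp (-(Real.pi / N * t.im)) *
        Real.exp (-(Real.pi * |(m : ℝ)|)) := by
    intro m
    rw [hinner, psiLimitTerm]
    by_cases h : m ≠ 0 ∧ (m : ZMod N) = v.1
    · simp only [if_pos h]
      have hm : (1 : ℝ) ≤ |(m : ℝ)| := by exact_mod_cast Int.one_le_abs h.1
      have habs : |((m : ℂ) * t + v.2.val).im| = |(m : ℝ)| * t.im := by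
        rw [im_int_mul_add_nat, abs_mul, abs_of_pos ht0]
      have := hC (m * t + v.2.val) (m * z + v.2.val) (z - t) m
        (by rw [habs]; nlinarith)
        (by rw [im_int_mul_add_nat]; exact mul_ne_zero (by exact_mod_cast h.1) hz) h.1 (by ring)
      have hsgn : (SignType.sign ((m : ℂ) * t + v.2.val).im) = SignType.sign m := by
        rw [im_int_mul_add_nat, sign_mul, sign_pos ht0, mul_one, sign_intCast]
      rw [hsgn, habs] at this
      have e : ∑' l : ℤ, psiTerm n z t (m, v.2.val + N * l) = ∑' l : ℤ,
          ((z - t) / ((m : ℂ) * t + v.2.val + N * l)) ^ (n + 1) /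
            ((m : ℂ) * z + v.2.val + N * l) := by
        refine tsum_congr fun l => ?_
        simp only [psiTerm]
        push_cast
        rw [add_assoc, add_assoc]
      rw [e]
      refine this.trans ?_
      rw [mul_assoc _ (Real.exp _)]
      gcongr
      exact exp_le_exp_mul_exp ht h.1
    · simp only [if_neg h, sub_zero, norm_zero]
      positivity
  have hS := summable_exp_neg_pi_mul_abs.mul_left
    (C * (1 + ‖z - t‖) ^ n * Real.exp (-(Real.pi / N * t.im)))
  have hdiff : Summable fun m => inner m - psiLimitTerm N n v z m := Summable.of_norm_bounded hS hb
  have hlim : Summable fun m => psiLimitTerm N n v z m := by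
    refine (hs1.sub hdiff).congr fun m => ?_
    rw [sub_sub_cancel]
  refine ⟨hlim, ?_⟩
  rw [psi, hs2, h0, add_sub_cancel_left, psiLimit, ← Summable.tsum_sub hs1 hlim]
  refine (tsum_of_norm_bounded hS.hasSum hb).trans_eq ?_
  rw [tsum_mul_left]
  ring

/-- The Eisenstein series tends to its constant term exponentially fast. -/
lemma exists_bound_eisC {N n : ℕ} [NeZero N] (hn : 1 ≤ n) (v : ZMod N × ZMod N) :
    ∃ C : ℝ, ∀ t : ℂ, N ≤ t.im →
    ‖eisC N n v t - cuspValue N (n + 2) v‖ ≤ C * Real.exp (-(Real.pi / N * t.im)) := by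
  obtain ⟨C, hC0, hC⟩ := exists_bound_tsum_inv_pow N (j := n + 2) (by omega)
  have hN0 : (0 : ℝ) < N := by exact_mod_cast Nat.pos_of_ne_zero (NeZero.ne N)
  refine ⟨C * ∑' m : ℤ, Real.exp (-(Real.pi * |(m : ℝ)|)), fun t ht => ?_⟩
  have ht0 : 0 < t.im := hN0.trans_le ht
  obtain ⟨hs1, hs2⟩ := tsum_latticePts v
    (summable_inv_linear_pow (k := n + 2) (by omega) ht0.ne') (by simp)
  have hb : ∀ m : ℤ, ‖if m ≠ 0 ∧ (m : ZMod N) = v.1 then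
      ∑' l : ℤ, 1 / ((m : ℂ) * t + ((v.2.val + N * l : ℤ) : ℂ)) ^ (n + 2) else 0‖ ≤
      C * Real.exp (-(Real.pi / N * t.im)) * Real.exp (-(Real.pi * |(m : ℝ)|)) := by
    intro m
    split_ifs with h
    · have hm : (1 : ℝ) ≤ |(m : ℝ)| := by exact_mod_cast Int.one_le_abs h.1
      have habs : |((m : ℂ) * t + v.2.val).im| = |(m : ℝ)| * t.im := by
        rw [im_int_mul_add_nat, abs_mul, abs_of_pos ht0]
      have := hC (m * t + v.2.val) (by rw [habs]; nlinarith)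
      rw [habs] at this
      push_cast
      simp only [← add_assoc]
      refine this.trans ?_
      rw [mul_assoc]
      gcongr
      exact exp_le_exp_mul_exp ht h.1
    · rw [norm_zero]
      positivity
  have hS := summable_exp_neg_pi_mul_abs.mul_left (C * Real.exp (-(Real.pi / N * t.im)))
  have h0 : (if v.1 = 0 then ∑' l : ℤ, (if (l : ZMod N) = v.2 then
      1 / (((0 : ℤ) : ℂ) * t + (l : ℂ)) ^ (n + 2) else 0) else 0) = cuspValue N (n + 2) v := by
    simp [cuspValue]
  rw [eisC, hs2, h0, add_sub_cancel_left]
  refine (tsum_of_norm_bounded hS.hasSum hb).trans_eq ?_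
  rw [tsum_mul_left]
  ring

/-! ### The constant `AG` -/

lemma sum_cos_zmod (N : ℕ) [NeZero N] (m : ℤ) :
    ∑ b : ZMod N, Real.cos (2 * Real.pi * (b.val * m) / N) =
      if (m : ZMod N) = 0 then (N : ℝ) else 0 := by
  have h := AddChar.sum_mulShift (m : ZMod N) (ZMod.isPrimitive_stdAddChar N)
  rw [ZMod.card] at h
  have h' := congrArg Complex.re h
  rw [Complex.re_sum] at h'
  have e : (((if (m : ZMod N) = 0 then N else 0 : ℕ) : ℂ)).re =
      if (m : ZMod N) = 0 then (N : ℝ) else 0 := by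
    split_ifs <;> simp
  rw [← e, ← h']
  refine Finset.sum_congr rfl fun b _ => ?_
  have e2 : (b * (m : ZMod N)) = (((b.val * m : ℤ)) : ZMod N) := by
    push_cast
    rw [ZMod.natCast_zmod_val]
  rw [e2, ZMod.stdAddChar_coe, show 2 * (Real.pi : ℂ) * I * ((b.val * m : ℤ) : ℂ) / N =
    ((2 * Real.pi * (b.val * m) / N : ℝ) : ℂ) * I by push_cast; ring, Complex.exp_ofReal_mul_I_re]

lemma sum_cos_mul_cos_zmod (N : ℕ) [NeZero N] (c : ZMod N) (l : ℤ) :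
    ∑ b : ZMod N, Real.cos (2 * Real.pi * b.val / N * l) *
      Real.cos (2 * Real.pi * (-(b.val * c.val : ℤ) : ℤ) / N) =
    N / 2 * ((if (l : ZMod N) = c then 1 else 0) + if ((-l : ℤ) : ZMod N) = c then 1 else 0) := by
  have h1 := sum_cos_zmod N (l - c.val)
  have h2 := sum_cos_zmod N (l + c.val)
  have e : ∀ b : ZMod N, Real.cos (2 * Real.pi * b.val / N * l) *
      Real.cos (2 * Real.pi * (-(b.val * c.val : ℤ) : ℤ) / N) =
      1 / 2 * (Real.cos (2 * Real.pi * (b.val * (l - c.val : ℤ)) / N) +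
        Real.cos (2 * Real.pi * (b.val * (l + c.val : ℤ)) / N)) := by
    intro b
    push_cast
    have a1 : 2 * Real.pi * (b.val * ((l : ℝ) - c.val)) / N =
      2 * Real.pi * b.val / N * l - 2 * Real.pi * (b.val * c.val) / N := by ring
    have a2 : 2 * Real.pi * (b.val * ((l : ℝ) + c.val)) / N =
      2 * Real.pi * b.val / N * l + 2 * Real.pi * (b.val * c.val) / N := by ring
    rw [a1, a2, Real.cos_sub, Real.cos_add, mul_neg, neg_div, Real.cos_neg]
    ring
  rw [Finset.sum_congr rfl fun b _ => e b, ← Finset.mul_sum, Finset.sum_add_distrib, h1, h2]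
  have i1 : ((l - c.val : ℤ) : ZMod N) = 0 ↔ (l : ZMod N) = c := by
    push_cast
    rw [ZMod.natCast_zmod_val, sub_eq_zero]
  have i2 : ((l + c.val : ℤ) : ZMod N) = 0 ↔ ((-l : ℤ) : ZMod N) = c := by
    push_cast
    rw [ZMod.natCast_zmod_val, add_eq_zero_iff_neg_eq]
  simp only [i1, i2]
  split_ifs <;> ring

lemma sum_sin_mul_sin_zmod (N : ℕ) [NeZero N] (c : ZMod N) (l : ℤ) :
    ∑ b : ZMod N, Real.sin (2 * Real.pi * b.val / N * l) *
      Real.sin (2 * Real.pi * (-(b.val * c.val : ℤ) : ℤ) / N) =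
    -(N / 2 * ((if (l : ZMod N) = c then 1 else 0) - if ((-l : ℤ) : ZMod N) = c then 1 else 0)) := by
  have h1 := sum_cos_zmod N (l - c.val)
  have h2 := sum_cos_zmod N (l + c.val)
  have e : ∀ b : ZMod N, Real.sin (2 * Real.pi * b.val / N * l) *
      Real.sin (2 * Real.pi * (-(b.val * c.val : ℤ) : ℤ) / N) =
      -(1 / 2) * (Real.cos (2 * Real.pi * (b.val * (l - c.val : ℤ)) / N) -
        Real.cos (2 * Real.pi * (b.val * (l + c.val : ℤ)) / N)) := by
    intro b
    push_cast
    have a1 : 2 * Real.pi * (b.val * ((l : ℝ) - c.val)) / N =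
      2 * Real.pi * b.val / N * l - 2 * Real.pi * (b.val * c.val) / N := by ring
    have a2 : 2 * Real.pi * (b.val * ((l : ℝ) + c.val)) / N =
      2 * Real.pi * b.val / N * l + 2 * Real.pi * (b.val * c.val) / N := by ring
    rw [a1, a2, Real.cos_sub, Real.cos_add, mul_neg, neg_div, Real.sin_neg]
    ring
  rw [Finset.sum_congr rfl fun b _ => e b, ← Finset.mul_sum, Finset.sum_sub_distrib, h1, h2]
  have i1 : ((l - c.val : ℤ) : ZMod N) = 0 ↔ (l : ZMod N) = c := by
    push_cast
    rw [ZMod.natCast_zmod_val, sub_eq_zero]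
  have i2 : ((l + c.val : ℤ) : ZMod N) = 0 ↔ ((-l : ℤ) : ZMod N) = c := by
    push_cast
    rw [ZMod.natCast_zmod_val, add_eq_zero_iff_neg_eq]
  simp only [i1, i2]
  split_ifs <;> ring

/-- Clausen's trigonometric function: cosine for odd order, sine for even order. -/
noncomputable def clTrig (m : ℕ) (x : ℝ) : ℝ := if Odd m then Real.cos x else Real.sin x

lemma summable_one_div_succ_pow {m : ℕ} (hm : 2 ≤ m) :
    Summable fun l : ℕ => 1 / ((l : ℝ) + 1) ^ m := by
  have := (summable_nat_add_iff 1).mpr (Real.summable_one_div_nat_pow.mpr (by omega : 1 < m))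
  simpa using this

lemma hasSum_Cl {m : ℕ} (hm : 2 ≤ m) (x : ℝ) :
    HasSum (fun l : ℕ => 1 / ((l : ℝ) + 1) ^ m * clTrig m (x * (l + 1 : ℤ))) (Cl m x) := by
  have hterm : ∀ l : ℕ, cexp (I * x) ^ (l + 1) / ((l : ℂ) + 1) ^ m =
      ((1 / ((l : ℝ) + 1) ^ m : ℝ) : ℂ) * cexp ((x * (l + 1 : ℤ) : ℝ) * I) := by
    intro l
    rw [← Complex.exp_nat_mul]
    push_cast
    rw [one_div_mul_eq_div]
    congr 2
    ring
  have hs : Summable fun l : ℕ => cexp (I * x) ^ (l + 1) / ((l : ℂ) + 1) ^ m := by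
    refine Summable.of_norm_bounded (summable_one_div_succ_pow hm) fun l => ?_
    rw [hterm, norm_mul, Complex.norm_exp_ofReal_mul_I, mul_one, Complex.norm_real,
      Real.norm_of_nonneg (by positivity)]
  rw [Cl, Li]
  unfold clTrig
  split_ifs
  · refine (Complex.hasSum_re hs.hasSum).congr_fun fun l => ?_
    rw [hterm, Complex.re_ofReal_mul, Complex.exp_ofReal_mul_I_re]
  · refine (Complex.hasSum_im hs.hasSum).congr_fun fun l => ?_
    rw [hterm, Complex.im_ofReal_mul, Complex.exp_ofReal_mul_I_im]

/-- The Hurwitz zeta type sum in the constant `AG`. -/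
noncomputable def signSum (N n : ℕ) (c : ZMod N) : ℝ :=
  ∑' m : ℤ, if m ≠ 0 ∧ (m : ZMod N) = c then (SignType.sign m : ℝ) * (1 / m) ^ (n + 1) else 0

lemma signSum_eq {n : ℕ} (N : ℕ) (hn : 1 ≤ n) (c : ZMod N) :
    signSum N n c = ∑' l : ℕ, 1 / ((l : ℝ) + 1) ^ (n + 1) *
      ((if ((l + 1 : ℤ) : ZMod N) = c then 1 else 0) +
        (-1) ^ n * if ((-(l + 1 : ℤ) : ℤ) : ZMod N) = c then 1 else 0) := by
  have hs := summable_one_div_succ_pow (m := n + 1) (by omega)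
  have h1 : Summable fun l : ℕ => 1 / ((l : ℝ) + 1) ^ (n + 1) *
      (if ((l + 1 : ℤ) : ZMod N) = c then (1 : ℝ) else 0) := by
    refine Summable.of_norm_bounded hs fun l => ?_
    have : (0 : ℝ) ≤ 1 / ((l : ℝ) + 1) ^ (n + 1) := by positivity
    split_ifs
    · rw [mul_one, Real.norm_of_nonneg this]
    · simpa using this
  have h2 : Summable fun l : ℕ => 1 / ((l : ℝ) + 1) ^ (n + 1) *
      ((-1) ^ n * if ((-(l + 1 : ℤ) : ℤ) : ZMod N) = c then (1 : ℝ) else 0) := by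
    refine Summable.of_norm_bounded hs fun l => ?_
    have : (0 : ℝ) ≤ 1 / ((l : ℝ) + 1) ^ (n + 1) := by positivity
    split_ifs
    · rw [mul_one, norm_mul, norm_pow, norm_neg, norm_one, one_pow, mul_one,
        Real.norm_of_nonneg this]
    · simpa using this
  have h := HasSum.of_add_one_of_neg_add_one
    (f := fun m : ℤ => if m ≠ 0 ∧ (m : ZMod N) = c then
      (SignType.sign m : ℝ) * (1 / (m : ℝ)) ^ (n + 1) else 0)
    (h1.hasSum.congr_fun fun l => by
      have : (l : ℤ) + 1 ≠ 0 := by omega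
      have hp : SignType.sign ((l : ℤ) + 1) = 1 := sign_pos (by omega)
      simp only [ne_eq, this, not_false_eq_true, true_and, hp]
      split_ifs
      · push_cast
        simp
      · simp)
    (h2.hasSum.congr_fun fun l => by
      have : -((l : ℤ) + 1) ≠ 0 := by omega
      have hp : SignType.sign (-((l : ℤ) + 1)) = -1 := sign_neg (by omega)
      simp only [ne_eq, this, not_false_eq_true, true_and, hp]
      split_ifs
      · push_cast
        rw [one_div, inv_neg, neg_pow, ← one_div, one_div_pow]
        simp
        ring
      · simp)
  rw [signSum, h.tsum_eq]
  simp only [ne_eq, not_true_eq_false, false_and, if_false, add_zero]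
  rw [← Summable.tsum_add h1 h2]
  exact tsum_congr fun l => by rw [mul_add]

/-- Fourier inversion on ℤ/N. The parity of n selects cosine or sine in the Clausen series and in
the kernel alike, so orthogonality leaves the classes of c and -c, which are the positive and
negative m in `signSum`. -/
lemma sum_Cl_mul {n : ℕ} (N : ℕ) [NeZero N] (hn : 1 ≤ n) (c : ZMod N) :
    ∑ b : ZMod N, Cl (n + 1) (2 * Real.pi * b.val / N) *
      (if Even n then Real.cos (2 * Real.pi * (-(b.val * c.val : ℤ) : ℤ) / N)
        else Real.sin (2 * Real.pi * (-(b.val * c.val : ℤ) : ℤ) / N)) =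
    (-1) ^ n * (N / 2) * signSum N n c := by
  have h := hasSum_sum (s := Finset.univ) fun (b : ZMod N) _ =>
    (hasSum_Cl (m := n + 1) (by omega) (2 * Real.pi * b.val / N)).mul_right
      (if Even n then Real.cos (2 * Real.pi * (-(b.val * c.val : ℤ) : ℤ) / N)
        else Real.sin (2 * Real.pi * (-(b.val * c.val : ℤ) : ℤ) / N))
  rw [← h.tsum_eq, signSum_eq N hn, ← tsum_mul_left]
  refine tsum_congr fun l => ?_
  simp only [mul_assoc (1 / ((l : ℝ) + 1) ^ (n + 1))]
  rw [← Finset.mul_sum]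
  by_cases he : Even n
  · have ho : Odd (n + 1) := he.add_one
    simp only [clTrig, if_pos ho, if_pos he]
    rw [sum_cos_mul_cos_zmod, he.neg_one_pow]
    ring
  · have ho : ¬ Odd (n + 1) := by rwa [Nat.not_odd_iff_even, Nat.even_add_one]
    simp only [clTrig, if_neg ho, if_neg he]
    rw [sum_sin_mul_sin_zmod, (Nat.not_even_iff_odd.mp he).neg_one_pow]
    ring

/-- Only u = (0, b) contributes, and there the pairing is -bc, so the second component of v
disappears. -/
lemma AG_eq {n : ℕ} (N : ℕ) [NeZero N] (hn : 1 ≤ n) (v : ZMod N × ZMod N) :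
    AG N (n + 2) v = -(2 * Real.pi ^ 2 * (-1) ^ n / (N * (n + 1))) * signSum N n v.1 := by
  have hpar : Even (n + 2) ↔ Even n := by simp [Nat.even_add]
  have hsum : ∑ u : ZMod N × ZMod N, Axi N (n + 2) u *
      (if Even (n + 2) then Real.cos (2 * Real.pi * pairing N u v / N)
        else Real.sin (2 * Real.pi * pairing N u v / N)) =
      (-1) ^ (n + 1 + (n + 3) / 2) * (n.factorial / (2 * Real.pi) ^ n) *
        ((-1) ^ n * (N / 2) * signSum N n v.1) := by
    rw [← sum_Cl_mul N hn v.1, Fintype.sum_prod_type, Finset.sum_eq_single 0, Finset.mul_sum]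
    · refine Finset.sum_congr rfl fun b _ => ?_
      simp only [Axi, if_true, pairing, ZMod.val_zero, hpar]
      simp only [Nat.cast_zero, zero_mul, zero_sub, Nat.add_sub_cancel,
        show n + 2 - 1 = n + 1 from rfl, mul_assoc]
    · intro a _ ha
      simp [Axi, ha]
    · simp
  rw [AG, hsum]
  have hN : (N : ℝ) ≠ 0 := by exact_mod_cast NeZero.ne N
  have hfac : ((n + 2 - 1).factorial : ℝ) = (n + 1) * n.factorial := by
    rw [show n + 2 - 1 = n + 1 from rfl, Nat.factorial_succ]
    push_cast
    ring
  have hf0 : (n.factorial : ℝ) ≠ 0 := by exact_mod_cast n.factorial_ne_zero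
  have hn0 : (n : ℝ) + 1 ≠ 0 := by positivity
  -- The exponents ⌊k/2⌋, ⌈k/2⌉ and k - 1 add up to the odd number 2k - 1.
  have hsign : (-1 : ℝ) ^ ((n + 2) / 2) * (-1) ^ (n + 1 + (n + 3) / 2) = -1 := by
    rw [← pow_add, show (n + 2) / 2 + (n + 1 + (n + 3) / 2) = 2 * (n + 1) + 1 by omega]
    rw [pow_succ, pow_mul]
    norm_num
  rw [hfac]
  calc _ = ((-1 : ℝ) ^ ((n + 2) / 2) * (-1) ^ (n + 1 + (n + 3) / 2)) *
        ((2 * Real.pi) ^ (n + 2) / (2 * Real.pi) ^ n / 2) *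
        ((n.factorial : ℝ) / n.factorial) * ((N : ℝ) / N ^ 2) / (n + 1) *
        ((-1) ^ n * signSum N n v.1) := by
        field_simp
    _ = _ := by
        have hpi : (2 * Real.pi) ^ (n + 2) / (2 * Real.pi) ^ n / 2 = 2 * Real.pi ^ 2 := by
          rw [pow_add, mul_div_cancel_left₀ _ (by positivity)]
          ring
        rw [hsign, hpi, div_self hf0]
        field_simp

/-- The cotangent commutes with conjugation, so the terms depending on z cancel, while the purely
imaginary sign terms add up. The result is independent of z, which is why the constant polynomial is
a multiple of Y^(k-2). -/
lemma psiLimit_sub_conj {N n : ℕ} [NeZero N] (hn : 1 ≤ n) (v : ZMod N × ZMod N) {z : ℂ}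
    (hz : z.im ≠ 0) :
    -(Real.pi * I / ((n : ℂ) + 1)) *
      (psiLimit N n v z - (starRingEnd ℂ) (psiLimit N n v ((starRingEnd ℂ) z))) =
      (AG N (n + 2) v : ℂ) := by
  have h1 := (exists_bound_psi hn v hz).1
  have h2 := (exists_bound_psi hn v (im_conj_ne_zero hz)).1
  have hN : (N : ℂ) ≠ 0 := by exact_mod_cast NeZero.ne N
  have hn0 : (n : ℂ) + 1 ≠ 0 := by exact_mod_cast Nat.succ_ne_zero n
  rw [AG_eq N hn, psiLimit, psiLimit, Complex.conj_tsum, ← Summable.tsum_sub h1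
    (Complex.hasSum_conj'.mpr h2.hasSum).summable, signSum, ← tsum_mul_left, ← tsum_mul_left,
    Complex.ofReal_tsum]
  refine tsum_congr fun m => ?_
  unfold psiLimitTerm
  split_ifs with h
  · have hc : (starRingEnd ℂ) (cot (Real.pi * ((m * (starRingEnd ℂ) z + v.2.val) / N))) =
        cot (Real.pi * ((m * z + v.2.val) / N)) := by
      rw [← Complex.cot_conj]
      simp only [map_mul, map_div₀, map_add, map_natCast, map_intCast, conj_ofReal,
        Complex.conj_conj]
    simp only [map_mul, map_sub, map_neg, map_pow, map_div₀, map_one, map_natCast, map_intCast,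
      conj_I, conj_ofReal, hc]
    push_cast
    have hI : I ^ 2 = -1 := I_sq
    field_simp
    ring_nf
    rw [hI]
    ring
  · simp

open MeasureTheory

/-! ### The regularised integral -/

lemma tendsto_eisC {N n : ℕ} [NeZero N] (hn : 1 ≤ n) (v : ZMod N × ZMod N) :
    Tendsto (eisC N n v) (comap Complex.im atTop) (𝓝 (cuspValue N (n + 2) v)) := by
  obtain ⟨C, hC⟩ := exists_bound_eisC hn v
  have hN0 : (0 : ℝ) < N := by exact_mod_cast Nat.pos_of_ne_zero (NeZero.ne N)
  have hlim : Tendsto (fun t : ℂ => C * Real.exp (-(Real.pi / N * t.im)))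
      (comap Complex.im atTop) (𝓝 0) := by
    have h1 : Tendsto (fun y : ℝ => Real.pi / N * y) atTop atTop :=
      tendsto_id.const_mul_atTop (div_pos Real.pi_pos hN0)
    have := ((Real.tendsto_exp_neg_atTop_nhds_zero.comp h1).const_mul C).comp
      (tendsto_comap (f := Complex.im) (x := atTop))
    rw [mul_zero] at this
    exact this
  rw [tendsto_iff_norm_sub_tendsto_zero]
  refine squeeze_zero' (Eventually.of_forall fun _ => norm_nonneg _) ?_ hlim
  filter_upwards [preimage_mem_comap (Ici_mem_atTop (N : ℝ))] with t ht
  exact hC t ht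

/-- The coefficient of index 0 is the value at q = 0 of the cusp function, defined as a limit; the
limit of the series at the cusp therefore suffices. -/
lemma a0_eisG {N n : ℕ} [NeZero N] (hn : 1 ≤ n) (v : ZMod N × ZMod N) :
    a0 N (eisG N (n + 2) v) = cuspValue N (n + 2) v := by
  have hN0 : (0 : ℝ) < N := by exact_mod_cast Nat.pos_of_ne_zero (NeZero.ne N)
  have hlim : Tendsto (eisG N (n + 2) v ∘ ofComplex) (comap Complex.im atTop)
      (𝓝 (cuspValue N (n + 2) v)) := by
    refine (tendsto_eisC hn v).congr' ?_
    filter_upwards [preimage_mem_comap (Ioi_mem_atTop (0 : ℝ))] with t ht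
    exact (eisG_ofComplex N n v ht).symm
  rw [a0, UpperHalfPlane.qExpansion_coeff, Nat.factorial_zero, Nat.cast_one, inv_one, one_mul,
    iteratedDeriv_zero, UpperHalfPlane.cuspFunction, Function.Periodic.cuspFunction,
    Function.update_self]
  exact (hlim.comp (Function.Periodic.invQParam_tendsto hN0)).limUnder_eq

lemma im_add_mul_I (τ : ℂ) (s : ℝ) : (τ + s * I).im = τ.im + s := by simp

lemma tailIntegrand_eq {N n : ℕ} [NeZero N] (hn : 1 ≤ n) (v : ZMod N × ZMod N) (p : ℕ) (τ : ℍ)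
    {s : ℝ} (hs : 0 ≤ s) : tailIntegrand N (eisG N (n + 2) v) p τ s =
      (eisC N n v (τ + s * I) - cuspValue N (n + 2) v) * ((τ : ℂ) + s * I) ^ p * I := by
  rw [tailIntegrand, a0_eisG hn, eisG_ofComplex]
  rw [im_add_mul_I]
  have := τ.im_pos
  simp only [UpperHalfPlane.coe_im]
  linarith

lemma isBigO_add_mul_I_pow (τ : ℂ) (p : ℕ) :
    (fun s : ℝ => (τ + s * I) ^ p) =O[atTop] fun s : ℝ => s ^ p := by
  apply Asymptotics.IsBigO.pow
  apply Asymptotics.IsBigO.add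
  · exact (Asymptotics.isLittleO_const_id_atTop τ).isBigO
  · refine Asymptotics.IsBigO.of_bound 1 (Eventually.of_forall fun s => ?_)
    simp

lemma isLittleO_pow_mul_exp (p : ℕ) {b : ℝ} (hb : 0 < b) :
    (fun s : ℝ => s ^ p * Real.exp (-(b * s))) =o[atTop] fun s => Real.exp (-(b / 2) * s) := by
  have h := (isLittleO_pow_exp_pos_mul_atTop p (half_pos hb)).mul_isBigO
    (Asymptotics.isBigO_refl (fun s : ℝ => Real.exp (-(b * s))) atTop)
  refine h.congr_right fun s => ?_
  rw [← Real.exp_add]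
  congr 1
  ring

lemma integrableOn_tailIntegrand {N n : ℕ} [NeZero N] (hn : 1 ≤ n) (v : ZMod N × ZMod N) (p : ℕ)
    (τ : ℍ) : IntegrableOn (tailIntegrand N (eisG N (n + 2) v) p τ) (Set.Ioi (0 : ℝ)) := by
  obtain ⟨C, hC⟩ := exists_bound_eisC hn v
  have hN0 : (0 : ℝ) < N := by exact_mod_cast Nat.pos_of_ne_zero (NeZero.ne N)
  have hb : 0 < Real.pi / N := div_pos Real.pi_pos hN0
  have him : ∀ s : ℝ, 0 ≤ s → 0 < ((τ : ℂ) + s * I).im := by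
    intro s hs
    have := τ.im_pos
    rw [im_add_mul_I]
    simp only [UpperHalfPlane.coe_im]
    linarith
  suffices h : ContinuousOn (tailIntegrand N (eisG N (n + 2) v) p τ) (Set.Ici 0) ∧
      tailIntegrand N (eisG N (n + 2) v) p τ =O[atTop]
        fun s : ℝ => Real.exp (-(Real.pi / N / 2) * s) from
    (integrableOn_Ici_iff_integrableOn_Ioi (by finiteness)).mp
      ((h.1.locallyIntegrableOn measurableSet_Ici).integrableOn_of_isBigO_atTop h.2
        ⟨Set.Ioi 0, Ioi_mem_atTop 0, exp_neg_integrableOn_Ioi 0 (half_pos hb)⟩)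
  constructor
  · have hcont : ContinuousOn (fun s : ℝ =>
        (eisC N n v (τ + s * I) - cuspValue N (n + 2) v) * ((τ : ℂ) + s * I) ^ p * I)
        (Set.Ici 0) := by
      have h1 : ContinuousOn (fun s : ℝ => eisC N n v (τ + s * I)) (Set.Ici 0) :=
        (differentiableOn_eisC hn v).continuousOn.comp (by fun_prop) fun s hs => him s hs
      fun_prop
    exact hcont.congr fun s hs => tailIntegrand_eq hn v p τ hs
  · refine Asymptotics.IsBigO.trans ?_ (isLittleO_pow_mul_exp p hb).isBigO
    have h1 : (fun s : ℝ => eisC N n v (τ + s * I) - cuspValue N (n + 2) v) =O[atTop]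
        fun s : ℝ => Real.exp (-(Real.pi / N * s)) := by
      refine Asymptotics.IsBigO.of_bound |C| ?_
      filter_upwards [eventually_ge_atTop (N : ℝ)] with s hs
      have hτ := τ.im_pos
      have e : ((τ : ℂ) + s * I).im = τ.im + s := by
        rw [im_add_mul_I, UpperHalfPlane.coe_im]
      refine (hC _ (by rw [e]; linarith)).trans ?_
      rw [e, Real.norm_of_nonneg (Real.exp_pos _).le]
      have : Real.exp (-(Real.pi / N * (τ.im + s))) ≤ Real.exp (-(Real.pi / N * s)) := by
        apply Real.exp_le_exp.mpr
        nlinarith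
      calc _ ≤ |C| * Real.exp (-(Real.pi / N * (τ.im + s))) := by
            gcongr
            exact le_abs_self C
        _ ≤ _ := by gcongr
    have h2 : (fun s : ℝ => (eisC N n v (τ + s * I) - cuspValue N (n + 2) v) *
        ((τ : ℂ) + s * I) ^ p * I) =O[atTop] fun s : ℝ =>
        Real.exp (-(Real.pi / N * s)) * s ^ p * 1 :=
      (h1.mul (isBigO_add_mul_I_pow τ p)).mul
        (Asymptotics.isBigO_const_const I one_ne_zero atTop)
    refine (h2.congr' ?_ (Eventually.of_forall fun s => ?_))
    · filter_upwards [eventually_ge_atTop (0 : ℝ)] with s hs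
      exact (tailIntegrand_eq hn v p τ hs).symm
    · ring

lemma sum_choose_mul_pow (n : ℕ) (z w : ℂ) :
    ∑ p ∈ Finset.range (n + 1), (n.choose p : ℂ) * (-1) ^ p * z ^ (n - p) * w ^ p =
      (z - w) ^ n := by
  rw [show z - w = -w + z by ring, add_pow]
  refine Finset.sum_congr rfl fun p _ => ?_
  rw [neg_pow]
  ring

/-- Both sides are the integral of (z - x)^n over x from 0 to w. The algebraic proof compares with
the binomial expansion of (z - w)^(n+1), whose term of index 0 is z^(n+1). -/
lemma sum_choose_mul_pow_div (n : ℕ) (z w : ℂ) :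
    ∑ p ∈ Finset.range (n + 1), (n.choose p : ℂ) * (-1) ^ p * z ^ (n - p) *
      (w ^ (p + 1) / ((p : ℂ) + 1)) = (z ^ (n + 1) - (z - w) ^ (n + 1)) / ((n : ℂ) + 1) := by
  have hn0 : (n : ℂ) + 1 ≠ 0 := by exact_mod_cast Nat.succ_ne_zero n
  rw [eq_div_iff hn0, ← sum_choose_mul_pow (n + 1) z w, Finset.sum_range_succ' _ (n + 1),
    Finset.sum_mul]
  simp only [Nat.choose_zero_right, Nat.cast_one, pow_zero, mul_one, one_mul, Nat.sub_zero]
  rw [sub_add_cancel_right, ← Finset.sum_neg_distrib]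
  refine Finset.sum_congr rfl fun p _ => ?_
  have hp : (p : ℂ) + 1 ≠ 0 := by exact_mod_cast Nat.succ_ne_zero p
  have h : ((n : ℂ) + 1) * n.choose p = (n + 1).choose (p + 1) * (p + 1) := by
    exact_mod_cast Nat.add_one_mul_choose_eq n p
  rw [Nat.add_sub_add_right]
  field_simp
  rw [pow_succ (-1 : ℂ)]
  linear_combination ((-1 : ℂ) ^ p * z ^ (n - p) * w ^ (p + 1)) * h

/-- The fundamental theorem of calculus on the vertical ray, for ψ(z, t) - a_0 (z - t)^(n+1), which
tends to `psiLimit`. The regularising terms contribute a_0 ((z - τ)^(n+1) - z^(n+1)), up to the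
factor 1/(n+1), and this cancels the power of z - τ. -/
lemma sum_regIntegral {N n : ℕ} [NeZero N] (hn : 1 ≤ n) (v : ZMod N × ZMod N) {z : ℂ}
    (hz : z.im ≠ 0) (τ : ℍ) :
    ∑ p ∈ Finset.range (n + 1), (n.choose p : ℂ) * (-1) ^ p * z ^ (n - p) *
      regIntegral N (eisG N (n + 2) v) p τ =
    (psi N n v z τ - psiLimit N n v z - cuspValue N (n + 2) v * z ^ (n + 1)) / ((n : ℂ) + 1) := by
  obtain ⟨-, C, hC⟩ := exists_bound_psi hn v hz
  have hN0 : (0 : ℝ) < N := by exact_mod_cast Nat.pos_of_ne_zero (NeZero.ne N)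
  have hb : 0 < Real.pi / N := div_pos Real.pi_pos hN0
  have hn0 : (n : ℂ) + 1 ≠ 0 := by exact_mod_cast Nat.succ_ne_zero n
  set c := cuspValue N (n + 2) v with hc
  set g : ℝ → ℂ := fun s => ∑ p ∈ Finset.range (n + 1),
    (n.choose p : ℂ) * (-1) ^ p * z ^ (n - p) * tailIntegrand N (eisG N (n + 2) v) p τ s with hg
  have hgint : IntegrableOn g (Set.Ioi 0) :=
    integrable_finsetSum _ fun p _ => (integrableOn_tailIntegrand hn v p τ).const_mul _
  have hgeq : ∀ s : ℝ, 0 ≤ s → g s =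
      (eisC N n v (τ + s * I) - c) * (z - (τ + s * I)) ^ n * I := by
    intro s hs
    rw [hg, ← sum_choose_mul_pow, Finset.mul_sum, Finset.sum_mul]
    refine Finset.sum_congr rfl fun p _ => ?_
    rw [tailIntegrand_eq hn v p τ hs]
    ring
  have hsum : ∑ p ∈ Finset.range (n + 1), (n.choose p : ℂ) * (-1) ^ p * z ^ (n - p) *
      ∫ s in Set.Ioi (0 : ℝ), tailIntegrand N (eisG N (n + 2) v) p τ s =
      ∫ s in Set.Ioi (0 : ℝ), g s := by
    rw [hg, integral_finsetSum _ fun p _ => (integrableOn_tailIntegrand hn v p τ).const_mul _]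
    exact Finset.sum_congr rfl fun p _ => (integral_const_mul _ _).symm
  have hderiv : ∀ s ∈ Set.Ici (0 : ℝ), HasDerivAt
      (fun s : ℝ => psi N n v z (τ + s * I) - c * (z - (τ + s * I)) ^ (n + 1))
      (-((n : ℂ) + 1) * g s) s := by
    intro s hs
    have him : 0 < ((τ : ℂ) + s * I).im := by
      have := τ.im_pos
      rw [im_add_mul_I]
      simp only [UpperHalfPlane.coe_im]
      have : 0 ≤ s := hs
      linarith
    have hline : HasDerivAt (fun s : ℝ => (τ : ℂ) + s * I) I s := by
      simpa using ((Complex.ofRealCLM.hasDerivAt (x := s)).mul_const I).const_add (τ : ℂ)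
    have h1 := (hasDerivAt_psi hn v hz him).comp s hline
    have h2 := ((hline.const_sub z).pow (n + 1)).const_mul c
    refine (h1.sub h2).congr_deriv ?_
    rw [hgeq s hs, Nat.add_sub_cancel]
    push_cast
    ring
  have htends : Tendsto
      (fun s : ℝ => psi N n v z (τ + s * I) - c * (z - (τ + s * I)) ^ (n + 1)) atTop
      (𝓝 (psiLimit N n v z)) := by
    rw [tendsto_iff_norm_sub_tendsto_zero]
    have hO : (fun s : ℝ => (1 + ‖z - (τ + s * I)‖) ^ n * Real.exp (-(Real.pi / N * s)))
        =O[atTop] fun s : ℝ => s ^ n * Real.exp (-(Real.pi / N * s)) := by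
      refine Asymptotics.IsBigO.mul (Asymptotics.IsBigO.pow (Asymptotics.IsBigO.add ?_ ?_) n)
        (Asymptotics.isBigO_refl _ _)
      · exact (Asymptotics.isLittleO_const_id_atTop (1 : ℝ)).isBigO
      · refine Asymptotics.IsBigO.norm_left (Asymptotics.IsBigO.sub
          (Asymptotics.isLittleO_const_id_atTop z).isBigO ?_)
        simpa using isBigO_add_mul_I_pow τ 1
    have hlim : Tendsto (fun s : ℝ => C * ((1 + ‖z - (τ + s * I)‖) ^ n *
        Real.exp (-(Real.pi / N * s)))) atTop (𝓝 0) := by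
      have h0 : Tendsto (fun s : ℝ => Real.exp (-(Real.pi / N / 2) * s)) atTop (𝓝 0) := by
        have := Real.tendsto_exp_neg_atTop_nhds_zero.comp
          (tendsto_id.const_mul_atTop (half_pos hb))
        refine this.congr fun s => ?_
        simp
      simpa using ((hO.trans (isLittleO_pow_mul_exp n hb).isBigO).trans_tendsto h0).const_mul C
    refine squeeze_zero' (Eventually.of_forall fun _ => norm_nonneg _) ?_ hlim
    filter_upwards [eventually_ge_atTop (N : ℝ)] with s hs
    have hτ := τ.im_pos
    have e : ((τ : ℂ) + s * I).im = τ.im + s := by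
      rw [im_add_mul_I, UpperHalfPlane.coe_im]
    have h1 := hC (τ + s * I) (by rw [e]; linarith)
    -- `exists_bound_psi` does not assert a sign, but C times a positive number bounds a norm.
    have hC0 : 0 ≤ C := by
      by_contra hneg
      have h2 : 0 < (1 + ‖z - (τ + s * I)‖) ^ n *
          Real.exp (-(Real.pi / N * ((τ : ℂ) + s * I).im)) := by positivity
      have := (norm_nonneg _).trans h1
      nlinarith [mul_neg_of_neg_of_pos (not_le.mp hneg) h2]
    refine h1.trans ?_
    rw [e]
    have : Real.exp (-(Real.pi / N * (τ.im + s))) ≤ Real.exp (-(Real.pi / N * s)) := by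
      apply Real.exp_le_exp.mpr
      nlinarith
    gcongr
  have hFTC := integral_Ioi_of_hasDerivAt_of_tendsto' hderiv (hgint.const_mul _) htends
  rw [integral_const_mul] at hFTC
  have hint : ∫ s in Set.Ioi (0 : ℝ), g s =
      (psi N n v z τ - c * (z - τ) ^ (n + 1) - psiLimit N n v z) / ((n : ℂ) + 1) := by
    rw [eq_div_iff hn0]
    simp only [ofReal_zero, zero_mul, add_zero] at hFTC
    linear_combination -hFTC
  simp only [regIntegral, mul_add, Finset.sum_add_distrib]
  rw [hsum, hint, a0_eisG hn, ← hc]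
  have := congrArg (fun x => -c * x) (sum_choose_mul_pow_div n z τ)
  simp only [Finset.mul_sum] at this
  have e : ∑ p ∈ Finset.range (n + 1), (n.choose p : ℂ) * (-1) ^ p * z ^ (n - p) *
      -(c * (τ : ℂ) ^ (p + 1) / ((p : ℂ) + 1)) =
      -c * ((z ^ (n + 1) - (z - τ) ^ (n + 1)) / ((n : ℂ) + 1)) := by
    rw [← this]
    exact Finset.sum_congr rfl fun p _ => by ring
  rw [e]
  field_simp
  ring

lemma ev_regPolyIntegral {N n : ℕ} [NeZero N] (hn : 1 ≤ n) (v : ZMod N × ZMod N) {z : ℂ}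
    (hz : z.im ≠ 0) (τ : ℍ) : ev z (regPolyIntegral N (n + 2) (eisG N (n + 2) v) τ) =
    -(2 * Real.pi * I / ((n : ℂ) + 1)) *
      (psi N n v z τ - psiLimit N n v z - cuspValue N (n + 2) v * z ^ (n + 1)) := by
  have h := congrArg (fun x => -(2 * (Real.pi : ℂ) * I) * x) (sum_regIntegral hn v hz τ)
  simp only [Finset.mul_sum] at h
  rw [regPolyIntegral, map_neg, map_sum, show n + 2 - 1 = n + 1 from rfl,
    show n + 2 - 2 = n from rfl, ← Finset.sum_neg_distrib]
  calc _ = _ := Finset.sum_congr rfl fun p _ => by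
        simp only [map_mul, map_pow, ev_C, ev_X, ev_Y]
        ring
    _ = _ := h
    _ = _ := by ring

/-! ### Comparison of the two sides and conclusion -/

lemma isHomogeneous_X : X.IsHomogeneous 1 := MvPolynomial.isHomogeneous_X ℂ 0

lemma isHomogeneous_Y : Y.IsHomogeneous 1 := MvPolynomial.isHomogeneous_X ℂ 1

lemma isHomogeneous_calG (N n : ℕ) [NeZero N] (v : ZMod N × ZMod N) (τ : ℍ) :
    (calG N (n + 2) v τ).IsHomogeneous n := by
  refine MvPolynomial.IsHomogeneous.add ?_ (isHomogeneous_rePoly ?_)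
  · simpa [PG] using (MvPolynomial.isHomogeneous_C (Fin 2) (AG N (n + 2) v : ℂ)).mul
      (isHomogeneous_Y.pow n)
  · refine MvPolynomial.IsHomogeneous.neg (MvPolynomial.IsHomogeneous.sum _ _ _ fun p hp => ?_)
    have h := ((MvPolynomial.isHomogeneous_C (Fin 2) (2 * (Real.pi : ℂ) * I *
      ((n + 2 - 2).choose p : ℂ) * (-1) ^ p * regIntegral N (eisG N (n + 2) v) p τ)).mul
      (isHomogeneous_X.pow (n + 2 - 2 - p))).mul (isHomogeneous_Y.pow p)
    have hp' : p < n + 1 := Finset.mem_range.mp hp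
    have e : 0 + 1 * (n + 2 - 2 - p) + 1 * p = n := by omega
    rwa [e] at h

/-- At (z, 1) both sides contain the same combination of ψ(z, τ) and the conjugate of ψ(z̄, τ). The
a_0 terms cancel, and the limits at the cusp are compensated by the constant polynomial. -/
lemma calG_eq_nonholPoly {N n : ℕ} [NeZero N] (hn : 1 ≤ n) (v : ZMod N × ZMod N) (τ : ℍ) :
    calG N (n + 2) v τ = nonholPoly N n v τ := by
  refine eq_of_ev_eq (isHomogeneous_calG N n v τ) (isHomogeneous_nonholPoly N n v τ)
    fun z hz => ?_
  rw [ev_nonholPoly hn v hz, calG, map_add, PG, ev_rePoly, ev_regPolyIntegral hn v hz,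
    ev_regPolyIntegral hn v (im_conj_ne_zero hz)]
  have hA := psiLimit_sub_conj hn v hz
  have hn0 : (n : ℂ) + 1 ≠ 0 := by exact_mod_cast Nat.succ_ne_zero n
  simp only [map_mul, map_pow, ev_C, ev_Y, one_pow, mul_one, map_neg, map_div₀, map_sub, map_add,
    map_one, map_natCast, conj_I, conj_ofReal, map_ofNat, Complex.conj_conj, conj_cuspValue]
  rw [← hA]
  ring

end EquivPrim

theorem theorem5p2 (N : ℕ) [NeZero N] (k : ℕ) (hk : 3 ≤ k) (v : ZMod N × ZMod N) :
    -- all the series and integrals involved converge absolutely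
    (∀ τ : UpperHalfPlane,
      Summable (fun p : EquivPrim.latticePts N v => EquivPrim.eisTerm k τ p) ∧
      (∀ rs ∈ Finset.HasAntidiagonal.antidiagonal (k - 2),
        Summable (fun p : EquivPrim.latticePts N v => EquivPrim.nonholTerm rs.1 rs.2 τ p)) ∧
      (∀ p ≤ k - 2, MeasureTheory.IntegrableOn
        (EquivPrim.tailIntegrand N (EquivPrim.eisG N k v) p τ) (Set.Ioi (0 : ℝ)))) ∧
    -- the formula for the equivariant primitive
    (∀ τ : UpperHalfPlane, EquivPrim.calG N k v τ =
      MvPolynomial.C (-(2 * (Real.pi : ℂ) / ((k : ℂ) - 1))) *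
        ∑ rs ∈ Finset.HasAntidiagonal.antidiagonal (k - 2),
          MvPolynomial.C (EquivPrim.nonholG N rs.1 rs.2 v τ) *
            EquivPrim.lin (τ : ℂ) ^ rs.1 *
            EquivPrim.lin ((starRingEnd ℂ) (τ : ℂ)) ^ rs.2) ∧
    -- it is the only equivariant primitive of the Eisenstein series
    (∀ F : UpperHalfPlane → EquivPrim.Poly,
      EquivPrim.IsEquivariantPrimitive N k (EquivPrim.eisG N k v) F ↔
        F = EquivPrim.calG N k v) := by
  obtain ⟨n, rfl⟩ : ∃ n, k = n + 2 := ⟨k - 2, by omega⟩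
  have hn : 1 ≤ n := by omega
  have hG : EquivPrim.calG N (n + 2) v = EquivPrim.nonholPoly N n v :=
    funext fun τ => EquivPrim.calG_eq_nonholPoly hn v τ
  have hP := EquivPrim.isEquivariantPrimitive_nonholPoly hn v
  refine ⟨fun τ => ⟨?_, fun rs hrs => ?_, fun p _ => ?_⟩, fun τ => ?_, fun F => ⟨fun hF => ?_, ?_⟩⟩
  · exact (EquivPrim.summable_inv_linear_pow hk τ.im_ne_zero).subtype _
  · rw [Finset.HasAntidiagonal.mem_antidiagonal] at hrs
    exact EquivPrim.summable_nonholTerm (by omega) v τ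
  · exact EquivPrim.integrableOn_tailIntegrand hn v p τ
  · have e : (((n + 2 : ℕ) : ℂ) - 1) = (n : ℂ) + 1 := by
      push_cast
      ring
    rw [EquivPrim.calG_eq_nonholPoly hn, e]
    rfl
  · rw [hG]
    exact hF.unique hk hP
  · rintro rfl
    rw [hG]
    exact hP
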